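/- Let $X$ be a real $k\times t$ matrix of rank $t$ whose column space contains $J_k=(1,\dots,1)^T$, and for $\theta\in\mathbb R^t$ let $m(\theta)=\exp(X\theta)$ (componentwise). Let $X_0$ be the $k\times c$ matrix of the sampling scheme: either $c=0$ (Poisson sampling), or $c\ge 1$, the $k$ cells are split into $c$ nonempty strata, and the columns of $X_0$ are the indicators of the strata (multinomial sampling for $c=1$, product-multinomial for $c\ge2$). Let $C$ be a $k\times r$ matrix, $L=(X_0,C)$, and assume $c+r\le t$, $\operatorname{rank}L=c+r$ and $\mathcal C(X_0)\subset\mathcal C(X)$ (column spaces). Given a table of counts $n=(n_1,\dots,n_k)^T$ and $d^*\in\mathbb R^r$, the loglinear model with linear constraints has the parameter space $$\Theta=\{\theta\in\mathbb R^t: X_0^Tm(\theta)=X_0^Tn,\ C^Tm(\theta)=d^*\}.$$ Let $\phi:[0,\infty)\to\mathbb R\cup\{\infty\}$ be convex, and differentiable on $(0,\infty)$, with $\phi(1)=\phi'(1)=0$ and $\phi''(1)>0$. Let $D_\phi(a,b)=\sum_{i=1}^k b_i\,\phi(a_i/b_i)$, with $0\,\phi(0/0)=0$ and $0\,\phi(p/0)=p\lim_{u\to\infty}\phi(u)/u$.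 Let $\hat\theta^\phi\in\arg\min_{\theta\in\Theta}D_\phi(n,m(\theta))$ be a minimum $\phi$-divergence estimator, that is, a function of the table $n$ that is a minimizer whenever a minimizer exists. Let $\theta_0$ be the true parameter, with $C^Tm(\theta_0)=d^*$. For $c=0$ the counts $n_i$ are independent Poisson variables with means $m_i(\theta_0)$. For $c\ge1$ the table has the law of such independent Poisson counts conditioned on $X_0^Tn=X_0^Tm(\theta_0)$, i.e. the (product-)multinomial law with prefixed stratum totals $X_0^Tm(\theta_0)$. Put $N=\sum_i m_i(\theta_0)$, and let $N\to\infty$ (along any sequence; $\theta_0$ and $d^*$ may vary with $N$) in such a way that $m^*=m(\theta_0)/N$ remains fixed, while $X$, $X_0$, $C$ and $\phi$ do not change. Let $D=\operatorname{diag}(m^*)$, $$I_F=X^TDX,\qquad B=X^TDL,\qquad H=I_F^{-1}-I_F^{-1}B\,(B^TI_F^{-1}B)^{-1}B^TI_F^{-1},$$ and assume that $B^TI_F^{-1}B$ is invertible. Then, as $N\to\infty$, a) $\sqrt N\,(\hat\theta^\phi-\theta_0)$ converges in law to $\mathcal N(0,H)$; b) $N^{-1/2}\bigl(m(\hat\theta^\phi)-m(\theta_0)\bigr)$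 converges in law to $\mathcal N(0,\,DXHX^TD)$. -/

import Mathlib

open MeasureTheory ProbabilityTheory Filter
open scoped Matrix

noncomputable section

namespace LMLC

/-- The mean vector of the loglinear model with design matrix `X`: `log m(θ) = X θ`. -/
def meanVec {k t : ℕ} (X : Matrix (Fin k) (Fin t) ℝ) (θ : Fin t → ℝ) : Fin k → ℝ :=
  fun i => Real.exp ((X *ᵥ θ) i)

/-- `X₀` is the matrix of a sampling scheme with `c` sampling constraints. Either `c = 0` (Poisson
sampling, no constraint), or the `k` cells are split into `c` nonempty strata (subtables), `s i`
being the stratum of the cell `i`, and the columns of `X₀` are the indicators of the strata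
(multinomial sampling if `c = 1`, product-multinomial sampling if `c ≥ 2`). -/
def IsSamplingMatrix {k c : ℕ} (X₀ : Matrix (Fin k) (Fin c) ℝ) : Prop :=
  c = 0 ∨ ∃ s : Fin k → Fin c, Function.Surjective s ∧
    ∀ i h, X₀ i h = if s i = h then 1 else 0

/-- The matrix `L = (X₀, C)` of all the linear constraints, those of the sampling scheme
and the `r` additional ones. -/
def constraintMatrix {k c r : ℕ} (X₀ : Matrix (Fin k) (Fin c) ℝ) (C : Matrix (Fin k) (Fin r) ℝ) :
    Matrix (Fin k) (Fin c ⊕ Fin r) ℝ :=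
  Matrix.fromCols X₀ C

/-- Loglinear model with linear constraints: design matrix `X`, sampling matrix `X₀`, and
matrix `C` of `r` additional linear constraints. (The system `Lᵀ m = d` is then consistent for
every `d`, because `L` has full column rank.) -/
structure IsLMLC {k t c r : ℕ} (X : Matrix (Fin k) (Fin t) ℝ) (X₀ : Matrix (Fin k) (Fin c) ℝ)
    (C : Matrix (Fin k) (Fin r) ℝ) : Prop where
  /-- `X` has full column rank. -/
  rank_design : X.rank = t
  /-- The vector of ones belongs to the column space of `X`. -/
  ones_mem : ∃ u : Fin t → ℝ, X *ᵥ u = fun _ => 1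
  isSamplingMatrix : IsSamplingMatrix X₀
  /-- The column space of `X₀` is contained in that of `X`. -/
  sampling_mem : ∀ v : Fin c → ℝ, ∃ u : Fin t → ℝ, X *ᵥ u = X₀ *ᵥ v
  card_le : c + r ≤ t
  rank_constraint : (constraintMatrix X₀ C).rank = c + r

/-- The parameter space, given the observed table `x`: `Lᵀ m(θ) = d` with `L = (X₀, C)` and
`d = (X₀ᵀ x, d*)`. -/
def paramSpace {k t c r : ℕ} (X : Matrix (Fin k) (Fin t) ℝ) (X₀ : Matrix (Fin k) (Fin c) ℝ)
    (C : Matrix (Fin k) (Fin r) ℝ) (dstar : Fin r → ℝ) (x : Fin k → ℕ) : Set (Fin t → ℝ) :=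
  {θ | (constraintMatrix X₀ C)ᵀ *ᵥ meanVec X θ
    = Sum.elim (X₀ᵀ *ᵥ fun i => (x i : ℝ)) dstar}

/-- The law of the table of counts when the mean vector is `m`: independent Poisson counts,
conditioned on the totals fixed by the sampling scheme, `X₀ᵀ n = X₀ᵀ m`. For `c = 0` nothing is
conditioned on, and this is the law of independent Poisson counts with means `m`; for
`c ≥ 1` it is the (product-)multinomial law with stratum totals `X₀ᵀ m`. -/
def samplingLaw {k c : ℕ} (X₀ : Matrix (Fin k) (Fin c) ℝ) (m : Fin k → ℝ) :
    Measure (Fin k → ℕ) :=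
  ProbabilityTheory.cond (Measure.pi fun i => poissonMeasure (m i).toNNReal)
    {x : Fin k → ℕ | (X₀ᵀ *ᵥ fun i => (x i : ℝ)) = X₀ᵀ *ᵥ m}

/-- The class `Φ` of convex functions `φ : [0, ∞) → ℝ ∪ {∞}`, differentiable on `(0, ∞)` (in
particular finite there; `φ 0 = ∞` is allowed), with `φ 1 = φ' 1 = 0` and `φ'' 1 > 0`. Only the
values on `[0, ∞)` matter. -/
structure IsPhi (φ : ℝ → EReal) : Prop where
  ne_bot : ∀ x, 0 ≤ x → φ x ≠ ⊥
  ne_top : ∀ x, 0 < x → φ x ≠ ⊤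
  convex : ∀ x y a b : ℝ, 0 ≤ x → 0 ≤ y → 0 ≤ a → 0 ≤ b → a + b = 1 →
    φ (a * x + b * y) ≤ (a : EReal) * φ x + (b : EReal) * φ y
  differentiable : DifferentiableOn ℝ (fun x => (φ x).toReal) (Set.Ioi 0)
  value_one : φ 1 = 0
  deriv_one : deriv (fun x => (φ x).toReal) 1 = 0
  deriv_two_one : 0 < deriv (deriv fun x => (φ x).toReal) 1

/-- One term `b φ(a / b)` of the divergence, with the conventions `0 φ(0 / 0) = 0` and
`0 φ(p / 0) = p lim_{u → ∞} φ(u) / u` (the limit exists for convex `φ`). -/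
def phiTerm (φ : ℝ → EReal) (a b : ℝ) : EReal :=
  if b = 0 then
    if a = 0 then 0 else (a : EReal) * limsup (fun u : ℝ => φ u / (u : EReal)) atTop
  else (b : EReal) * φ (a / b)

/-- The `φ`-divergence `D_φ(a, b)` between nonnegative vectors. -/
def phiDiv {k : ℕ} (φ : ℝ → EReal) (a b : Fin k → ℝ) : EReal :=
  ∑ i, phiTerm φ (a i) (b i)

/-- `θ` minimizes `D_φ(x, m(θ))` over the parameter space belonging to the table `x`. -/
def IsPhiMinimizer {k t c r : ℕ} (φ : ℝ → EReal) (X : Matrix (Fin k) (Fin t) ℝ)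
    (X₀ : Matrix (Fin k) (Fin c) ℝ) (C : Matrix (Fin k) (Fin r) ℝ) (dstar : Fin r → ℝ)
    (x : Fin k → ℕ) (θ : Fin t → ℝ) : Prop :=
  θ ∈ paramSpace X X₀ C dstar x ∧ ∀ θ' ∈ paramSpace X X₀ C dstar x,
    phiDiv φ (fun i => (x i : ℝ)) (meanVec X θ) ≤ phiDiv φ (fun i => (x i : ℝ)) (meanVec X θ')

/-- `T` is a minimum `φ`-divergence estimator: at every table at which a minimizer exists, `T`
picks one. (For some tables there is none, or there are several; no restriction is made on the
values of `T` at the former, nor on the choice at the latter. Such a `T` always exists.) -/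
def IsMinPhiEstimator {k t c r : ℕ} (φ : ℝ → EReal) (X : Matrix (Fin k) (Fin t) ℝ)
    (X₀ : Matrix (Fin k) (Fin c) ℝ) (C : Matrix (Fin k) (Fin r) ℝ) (dstar : Fin r → ℝ)
    (T : (Fin k → ℕ) → Fin t → ℝ) : Prop :=
  ∀ x, (∃ θ, IsPhiMinimizer φ X X₀ C dstar x θ) → IsPhiMinimizer φ X X₀ C dstar x (T x)

/-- The Fisher information matrix `I_F = Xᵀ D X`, `D` being the diagonal matrix of the normalized
mean vector `mstar`. -/
def fisherInfo {k t : ℕ} (X : Matrix (Fin k) (Fin t) ℝ) (mstar : Fin k → ℝ) :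
    Matrix (Fin t) (Fin t) ℝ :=
  Xᵀ * Matrix.diagonal mstar * X

/-- The matrix `B = Xᵀ D L`. -/
def bMatrix {k t c r : ℕ} (X : Matrix (Fin k) (Fin t) ℝ) (X₀ : Matrix (Fin k) (Fin c) ℝ)
    (C : Matrix (Fin k) (Fin r) ℝ) (mstar : Fin k → ℝ) : Matrix (Fin t) (Fin c ⊕ Fin r) ℝ :=
  Xᵀ * Matrix.diagonal mstar * constraintMatrix X₀ C

/-- The matrix `Bᵀ I_F⁻¹ B`, whose inverse enters the definition of `H`. -/
def bInfo {k t c r : ℕ} (X : Matrix (Fin k) (Fin t) ℝ) (X₀ : Matrix (Fin k) (Fin c) ℝ)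
    (C : Matrix (Fin k) (Fin r) ℝ) (mstar : Fin k → ℝ) :
    Matrix (Fin c ⊕ Fin r) (Fin c ⊕ Fin r) ℝ :=
  (bMatrix X X₀ C mstar)ᵀ * (fisherInfo X mstar)⁻¹ * bMatrix X X₀ C mstar

/-- The matrix `H = I_F⁻¹ - I_F⁻¹ B (Bᵀ I_F⁻¹ B)⁻¹ Bᵀ I_F⁻¹`. -/
def hMatrix {k t c r : ℕ} (X : Matrix (Fin k) (Fin t) ℝ) (X₀ : Matrix (Fin k) (Fin c) ℝ)
    (C : Matrix (Fin k) (Fin r) ℝ) (mstar : Fin k → ℝ) : Matrix (Fin t) (Fin t) ℝ :=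
  (fisherInfo X mstar)⁻¹ - (fisherInfo X mstar)⁻¹ * bMatrix X X₀ C mstar *
    (bInfo X X₀ C mstar)⁻¹ * (bMatrix X X₀ C mstar)ᵀ * (fisherInfo X mstar)⁻¹

/-- The matrix `Σ = D X H Xᵀ D`. -/
def sigmaMatrix {k t c r : ℕ} (X : Matrix (Fin k) (Fin t) ℝ) (X₀ : Matrix (Fin k) (Fin c) ℝ)
    (C : Matrix (Fin k) (Fin r) ℝ) (mstar : Fin k → ℝ) : Matrix (Fin k) (Fin k) ℝ :=
  Matrix.diagonal mstar * X * hMatrix X X₀ C mstar * Xᵀ * Matrix.diagonal mstar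

end LMLC

end

set_option linter.unusedSectionVars false

/-! Put `θ = θ₀ + η`, `w = mstar`, `p = n / N`. Almost surely `n` has the stratum totals of `m(θ₀)`,
so the constraints and, once all counts are positive, the divergence just scale by `N`: the
estimator becomes a minimizer of `relDiv` over `relSpace`, a problem in which only `p` varies. It
remains to differentiate the argmin at `p = w` and to find the limit law of `Z = √N (p - w)`.

The argmin. Since `φ'` is known to be differentiable only at `1`, the first order conditions cannot
simply be differentiated. What is used is a quadratic expansion at `1` and linear growth away from
it (`IsPhi.isQuadraticMin`). Growth forces minimizers to tend to `0`, and comparison with `η = 0`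
gives the rate `O(‖p - w‖)` (`minimizer_isBigO`). At that scale the divergence is `κ / 2` times a
weighted sum of squares, whose minimizer on the tangent space `ker Bᵀ` is `H Xᵀ (p - w)`. The
implicit function theorem supplies a feasible competitor close to this point, and Pythagoras'
identity puts every minimizer within `o(‖p - w‖)` of it (`minimizer_sub_isLittleO`). The factor `κ`
cancels, so the limit does not depend on `φ`.

The limit law. The characteristic functions of `Z` are explicit and tend to `exp(-Q / 2)`
(`exists_tendsto_integral_exp_samplingLaw`). `Q` depends on the sampling scheme, but `Bᵀ H = 0` and
`L` contains `X₀`, so the scores `X H v` are centered in every stratum; there each scheme gives `Q τ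
= ∑ wᵢ τᵢ²`, which is `vᵀ H v` because `H I_F H = H`. The delta method
`tendstoInDistribution_of_linearization` yields both claims. -/

noncomputable section

namespace LMLC

open Asymptotics Topology

/-! ### Convex functions with a nondegenerate minimum at 1 -/

/-- The properties of a real function on `(0, ∞)` with a nondegenerate minimum at `1` that the
asymptotics of minimum divergence estimators rests on: `f u = κ / 2 * (u - 1) ^ 2 + o((u - 1) ^ 2)`
near `1`, and at least linear growth away from `1`. -/
structure IsQuadraticMin (f : ℝ → ℝ) (κ : ℝ) : Prop where
  continuousOn : ContinuousOn f (Set.Ioi 0)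
  nonneg : ∀ u, 0 < u → 0 ≤ f u
  pos : 0 < κ
  expansion : (fun u => f u - κ / 2 * (u - 1) ^ 2) =o[𝓝 1] fun u => (u - 1) ^ 2
  linear_growth : ∀ ε, 0 < ε → ∃ c, 0 < c ∧ ∀ u, 0 < u → ε ≤ |u - 1| → c * |u - 1| ≤ f u

/-- Second order expansion at a critical zero whose derivative is differentiable there. -/
lemma isLittleO_sub_half_sq {f : ℝ → ℝ} {a κ : ℝ} (hf : ∀ᶠ x in 𝓝 a, DifferentiableAt ℝ f x)
    (h0 : f a = 0) (h1 : deriv f a = 0) (h2 : HasDerivAt (deriv f) κ a) :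
    (fun u => f u - κ / 2 * (u - a) ^ 2) =o[𝓝 a] fun u => (u - a) ^ 2 := by
  rw [isLittleO_iff]
  intro ε hε
  have h3 := (hasDerivAt_iff_isLittleO.1 h2)
  rw [isLittleO_iff] at h3
  obtain ⟨δ, hδ, h⟩ := Metric.eventually_nhds_iff_ball.1 ((h3 hε).and hf)
  refine Metric.eventually_nhds_iff_ball.2 ⟨δ, hδ, fun u hu => ?_⟩
  have hseg : ∀ x ∈ segment ℝ a u, x ∈ Metric.ball a δ ∧ |x - a| ≤ |u - a| := by
    intro x hx
    have h4 : |x - a| ≤ |u - a| := by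
      rw [segment_eq_uIcc] at hx
      exact Set.abs_sub_left_of_mem_uIcc hx
    refine ⟨?_, h4⟩
    rw [Metric.mem_ball, Real.dist_eq] at hu ⊢
    exact h4.trans_lt hu
  -- Mean value inequality for the remainder: its derivative is `o(x - a)` by differentiability of
  -- `deriv f` at the single point `a`.
  have key := (convex_segment a u).norm_image_sub_le_of_norm_hasDerivWithin_le
    (f := fun u => f u - κ / 2 * (u - a) ^ 2) (f' := fun x => deriv f x - κ * (x - a))
    (C := ε * |u - a|) (x := a) (y := u) ?_ ?_ (left_mem_segment ℝ a u) (right_mem_segment ℝ a u)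
  · simp only [h0, sub_self] at key
    calc _ = ‖f u - κ / 2 * (u - a) ^ 2 - (0 - κ / 2 * 0 ^ 2)‖ := by simp
      _ ≤ _ := key
      _ = _ := by rw [norm_pow, Real.norm_eq_abs]; ring
  · intro x hx
    have hd := (h x (hseg x hx).1).2.hasDerivAt
    have := hd.sub ((((hasDerivAt_id x).sub_const a).pow 2).const_mul (κ / 2))
    refine (this.congr_deriv ?_).hasDerivWithinAt
    simp
    ring
  · intro x hx
    have := (h x (hseg x hx).1).1
    simp only [h1, sub_zero, smul_eq_mul, Real.norm_eq_abs] at this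
    rw [Real.norm_eq_abs, mul_comm κ]
    exact this.trans (mul_le_mul_of_nonneg_left (hseg x hx).2 hε.le)

/-- Convexity makes the critical point `1` a global minimum, the expansion makes it strict nearby,
and convexity again turns strictness into linear growth: beyond a point near `1`, the graph lies
above the chord issuing from `1`. -/
lemma IsPhi.isQuadraticMin {φ : ℝ → EReal} (hφ : IsPhi φ) :
    IsQuadraticMin (fun x => (φ x).toReal) (deriv (deriv fun x => (φ x).toReal) 1) := by
  set f : ℝ → ℝ := fun x => (φ x).toReal with hf
  have hcoe : ∀ x, 0 < x → φ x = (f x : EReal) := fun x hx =>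
    (EReal.coe_toReal (hφ.ne_top x hx) (hφ.ne_bot x hx.le)).symm
  have h1 : f 1 = 0 := by simp [hf, hφ.value_one]
  have hconv : ConvexOn ℝ (Set.Ioi 0) f := by
    refine ⟨convex_Ioi 0, fun x hx y hy a b ha hb hab => ?_⟩
    have hxy : 0 < a * x + b * y := (convex_Ioi (0 : ℝ)) hx hy ha hb hab
    have := hφ.convex x y a b (le_of_lt hx) (le_of_lt hy) ha hb hab
    rw [hcoe x hx, hcoe y hy, hcoe _ hxy] at this
    exact_mod_cast this
  have hd : ∀ x, 0 < x → DifferentiableAt ℝ f x := fun x hx =>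
    (hφ.differentiable x hx).differentiableAt (Ioi_mem_nhds hx)
  have hpos := hφ.deriv_two_one
  have hexp := isLittleO_sub_half_sq (f := f) (a := 1)
    ((eventually_gt_nhds one_pos).mono hd) h1 hφ.deriv_one
    (differentiableAt_of_deriv_ne_zero hpos.ne').hasDerivAt
  have hnonneg : ∀ u, 0 < u → 0 ≤ f u := by
    have hmin : IsMinOn f (Set.Ioi 0) 1 := by
      refine hconv.isMinOn_of_rightDeriv_eq_zero (by simp) ?_
      rw [(hd 1 one_pos).derivWithin (uniqueDiffWithinAt_Ioi 1)]
      exact hφ.deriv_one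
    intro u hu
    have := hmin hu
    simpa [h1] using this
  refine ⟨fun x hx => (hd x hx).continuousAt.continuousWithinAt, hnonneg, hpos, hexp, ?_⟩
  intro ε hε
  set κ := deriv (deriv f) 1
  obtain ⟨δ, hδ, hball⟩ := Metric.eventually_nhds_iff_ball.1
    (isLittleO_iff.1 hexp (show 0 < κ / 4 by positivity))
  have hfpos : ∀ u, |u - 1| < δ → u ≠ 1 → 0 < f u := by
    intro u hu hu1
    have := hball u (by rwa [Metric.mem_ball, Real.dist_eq])
    rw [Real.norm_eq_abs, Real.norm_eq_abs, abs_of_nonneg (sq_nonneg (u - 1))] at this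
    have h4 := (abs_le.1 this).1
    have h5 : 0 < (u - 1) ^ 2 := by
      have := sub_ne_zero.2 hu1
      positivity
    nlinarith
  -- the distance from `1` of the chords used
  obtain ⟨τ, hτ0, hτε, hτδ, hτ1⟩ : ∃ τ, 0 < τ ∧ τ ≤ ε ∧ τ < δ ∧ τ < 1 :=
    ⟨min ε (min (δ / 2) (1 / 2)), by positivity, min_le_left _ _,
      (min_le_right _ _).trans_lt ((min_le_left _ _).trans_lt (by linarith)),
      (min_le_right _ _).trans_lt ((min_le_right _ _).trans_lt (by norm_num))⟩
  -- The sign `σ` selects the side of `1`; the point `1 + σ τ` lies between `1` and `u`.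
  have hchord : ∀ σ u, |σ| = 1 → 0 < u → τ ≤ σ * (u - 1) →
      f (1 + σ * τ) * (σ * (u - 1)) ≤ τ * f u := by
    intro σ u hσ hu hle
    have hσ2 : σ * σ = 1 := by rw [← abs_mul_abs_self, hσ, one_mul]
    have hs : 0 < σ * (u - 1) := hτ0.trans_le hle
    have := hconv.2 (Set.mem_Ioi.2 one_pos) (Set.mem_Ioi.2 hu)
      (show 0 ≤ 1 - τ / (σ * (u - 1)) by rw [sub_nonneg, div_le_one hs]; exact hle)
      (show 0 ≤ τ / (σ * (u - 1)) by positivity) (by ring)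
    have e : (1 - τ / (σ * (u - 1))) • (1 : ℝ) + (τ / (σ * (u - 1))) • u = 1 + σ * τ := by
      have hu1 : u - 1 ≠ 0 := right_ne_zero_of_mul hs.ne'
      have hσ0 : σ ≠ 0 := left_ne_zero_of_mul hs.ne'
      simp only [smul_eq_mul]
      field_simp
      linear_combination (τ - τ * u) * hσ2
    rw [e, h1, smul_zero, zero_add, smul_eq_mul, div_mul_eq_mul_div, le_div_iff₀ hs] at this
    exact this
  have hp := hfpos (1 + τ) (by simp [abs_of_pos hτ0, hτδ]) (by linarith)
  have hm := hfpos (1 - τ) (by simp [abs_of_pos hτ0, hτδ]) (by linarith)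
  refine ⟨min (f (1 + τ)) (f (1 - τ)) / τ, by positivity, fun u hu hle => ?_⟩
  rw [div_mul_eq_mul_div, div_le_iff₀ hτ0, mul_comm (f u)]
  rcases le_total 0 (u - 1) with h | h
  · rw [abs_of_nonneg h] at hle ⊢
    have := hchord 1 u (by simp) hu (by linarith)
    simp only [one_mul] at this
    exact (mul_le_mul_of_nonneg_right (min_le_left _ _) h).trans this
  · rw [abs_of_nonpos h] at hle ⊢
    have := hchord (-1) u (by simp) hu (by linarith)
    simp only [neg_mul, one_mul, ← sub_eq_add_neg] at this
    exact (mul_le_mul_of_nonneg_right (min_le_right _ _) (by linarith)).trans this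

/-! ### A single term of the divergence -/

section Scalar

variable {α : Type*} {l : Filter α} {f : ℝ → ℝ} {κ w : ℝ} {p b g x : α → ℝ}

lemma IsQuadraticMin.map_one (hf : IsQuadraticMin f κ) : f 1 = 0 := by
  have := (isLittleO_iff.1 hf.expansion one_pos).self_of_nhds
  simpa using this

/-- If `b f(p / b) → 0` and `p → w > 0` then `b → w`. -/
lemma IsQuadraticMin.tendsto_of_tendsto_term (hf : IsQuadraticMin f κ) (hw : 0 < w)
    (hp : Tendsto p l (𝓝 w)) (hb : ∀ a, 0 < b a)
    (h : Tendsto (fun a => b a * f (p a / b a)) l (𝓝 0)) : Tendsto b l (𝓝 w) := by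
  -- Either `p / b` is within `ε` of `1`, so `|p - b| ≤ ε b`, or linear growth bounds `|p - b|` by
  -- the term over `c`. Since `ε ≤ 1 / 2`, the bound `ε b` can be absorbed, leaving only `p` and the
  -- term.
  have key : ∀ ε, 0 < ε → ε ≤ 1 / 2 → ∃ c, 0 < c ∧ ∀ᶠ a in l,
      |p a - b a| ≤ 2 * ε * (p a + b a * f (p a / b a) / c) + b a * f (p a / b a) / c := by
    intro ε hε hε2
    obtain ⟨c, hc, hlin⟩ := hf.linear_growth ε hε
    refine ⟨c, hc, ?_⟩
    filter_upwards [hp.eventually (eventually_gt_nhds hw)] with a hpa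
    have hu : 0 < p a / b a := div_pos hpa (hb a)
    have hB : 0 ≤ b a * f (p a / b a) / c :=
      div_nonneg (mul_nonneg (hb a).le (hf.nonneg _ hu)) hc.le
    have hbu : b a * |p a / b a - 1| = |p a - b a| := by
      rw [← abs_of_pos (hb a), ← abs_mul, abs_of_pos (hb a), mul_sub, mul_one,
        mul_div_cancel₀ _ (hb a).ne']
    have h1 : |p a - b a| ≤ ε * b a + b a * f (p a / b a) / c := by
      rcases le_total ε |p a / b a - 1| with h' | h'
      · have := mul_le_mul_of_nonneg_left (hlin _ hu h') (hb a).le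
        have h2 : |p a - b a| ≤ b a * f (p a / b a) / c := by
          rw [le_div_iff₀ hc, ← hbu]
          linarith
        have := mul_pos hε (hb a)
        linarith
      · have := mul_le_mul_of_nonneg_left h' (hb a).le
        rw [hbu] at this
        linarith
    have h2 : b a ≤ 2 * (p a + b a * f (p a / b a) / c) := by
      have := (abs_le.1 h1).1
      nlinarith [hb a]
    nlinarith
  have hsub : Tendsto (fun a => p a - b a) l (𝓝 0) := by
    rw [Metric.tendsto_nhds]
    intro e he
    -- This makes the limiting bound `2 ε w` at most `e / 2`.
    set ε := min (1 / 2) (e / (4 * w)) with hε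
    have hε0 : 0 < ε := by positivity
    obtain ⟨c, hc, hk⟩ := key ε hε0 (min_le_left _ _)
    have hlim : Tendsto (fun a => 2 * ε * (p a + b a * f (p a / b a) / c)
        + b a * f (p a / b a) / c) l (𝓝 (2 * ε * (w + 0 / c) + 0 / c)) :=
      ((hp.add (h.div_const c)).const_mul _).add (h.div_const c)
    have hlt : 2 * ε * (w + 0 / c) + 0 / c < e := by
      have : ε * (4 * w) ≤ e := by
        rw [← le_div_iff₀ (by positivity)]; exact min_le_right _ _
      simp only [zero_div, add_zero]
      nlinarith
    filter_upwards [hk, hlim.eventually_lt_const hlt] with a h1 h2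
    rw [Real.dist_eq, sub_zero]
    exact h1.trans_lt h2
  simpa using hp.sub hsub

/-- Close to the minimum the terms of the divergence dominate the squared differences. -/
lemma IsQuadraticMin.sq_isBigO_term (hf : IsQuadraticMin f κ) (hw : 0 < w)
    (hp : Tendsto p l (𝓝 w)) (hb : Tendsto b l (𝓝 w)) :
    (fun a => (p a - b a) ^ 2) =O[l] fun a => b a * f (p a / b a) := by
  have hu : Tendsto (fun a => p a / b a) l (𝓝 1) := by
    have := hp.div hb hw.ne'
    rwa [div_self hw.ne'] at this
  have h1 : (fun u => (u - 1) ^ 2) =O[𝓝 1] f := by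
    have h2 := hf.expansion.trans_isBigO (isBigO_const_mul_self (κ / 2)⁻¹ _ _ |>.congr_left
      (f₁ := fun u : ℝ => (κ / 2)⁻¹ * (κ / 2 * (u - 1) ^ 2)) (f₂ := fun u => (u - 1) ^ 2)
      fun u => by have := hf.pos; field_simp)
    have h3 := IsEquivalent.isBigO_symm h2
    refine IsBigO.trans ?_ h3
    refine (isBigO_const_mul_self (κ / 2)⁻¹ _ _).congr_left fun u => by
      have := hf.pos; field_simp
  have h4 := (hb.isBigO_one ℝ).mul (isBigO_refl b l) |>.mul (h1.comp_tendsto hu)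
  refine (h4.congr' ?_ ?_)
  · filter_upwards [hb.eventually_ne hw.ne'] with a ha
    simp only [Function.comp_apply]
    field_simp
  · filter_upwards with a
    simp

/-- The quadratic expansion of a term `b f(p / b)` at `p = b = w`, where `b = w eˣ`. -/
lemma IsQuadraticMin.term_expansion (hf : IsQuadraticMin f κ) (hw : 0 < w)
    (hg : Tendsto g l (𝓝 0)) (hp : (fun a => p a - w) =O[l] g) (hx : x =O[l] g) :
    (fun a => w * Real.exp (x a) * f (p a / (w * Real.exp (x a)))
      - κ / 2 * ((p a - w - w * x a) ^ 2 / w)) =o[l] fun a => g a ^ 2 := by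
  set b : α → ℝ := fun a => w * Real.exp (x a) with hbdef
  have hx0 : Tendsto x l (𝓝 0) := hx.trans_tendsto hg
  have hpw : Tendsto p l (𝓝 w) := by
    simpa using (hp.trans_tendsto hg).add_const w
  have hbpos : ∀ a, 0 < b a := fun a => mul_pos hw (Real.exp_pos _)
  have hb : Tendsto b l (𝓝 w) := by
    simpa using ((Real.continuous_exp.tendsto 0).comp hx0).const_mul w
  have hexp : (fun a => Real.exp (x a) - 1 - x a) =o[l] g := by
    have h1 := (hasDerivAt_iff_isLittleO.1 (Real.hasDerivAt_exp 0)).comp_tendsto hx0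
    simp only [Real.exp_zero, sub_zero, smul_eq_mul, mul_one] at h1
    exact h1.trans_isBigO hx
  have hbe : (fun a => b a - w - w * x a) =o[l] g := by
    refine (hexp.const_mul_left w).congr_left fun a => by simp only [hbdef]; ring
  have hlin : (fun a => p a - w - w * x a) =O[l] g := hp.sub (hx.const_mul_left w)
  have hpb : (fun a => p a - b a) =O[l] g :=
    (hlin.sub hbe.isBigO).congr_left fun a => by ring
  have hu : Tendsto (fun a => p a / b a) l (𝓝 1) := by
    have := hpw.div hb hw.ne'
    rwa [div_self hw.ne'] at this
  have hbinv : (fun a => (b a)⁻¹) =O[l] fun _ => (1 : ℝ) := (hb.inv₀ hw.ne').isBigO_one ℝ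
  have hu1 : (fun a => p a / b a - 1) =O[l] g := by
    refine (hpb.mul hbinv).congr (fun a => ?_) fun a => mul_one _
    have := (hbpos a).ne'
    field_simp
  -- Three replacements, each at cost `o(g²)`: `f` by its quadratic part (`e1`), `b` by `w + w x`
  -- inside the square (`e2`), and `1 / b` by `1 / w` (`e3`).
  have e1 : (fun a => b a * (f (p a / b a) - κ / 2 * (p a / b a - 1) ^ 2)) =o[l]
      fun a => g a ^ 2 := by
    have := ((hb.isBigO_one ℝ).mul_isLittleO ((hf.expansion.comp_tendsto hu).trans_isBigO
      (hu1.pow 2)))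
    simpa using this
  have e2 : (fun a => ((p a - b a) ^ 2 - (p a - w - w * x a) ^ 2) * (b a)⁻¹) =o[l]
      fun a => g a ^ 2 := by
    refine ((hbe.neg_left.mul_isBigO (hpb.add hlin)).mul_isBigO hbinv).congr
      (fun a => by ring) fun a => by ring
  have e3 : (fun a => (p a - w - w * x a) ^ 2 * ((b a)⁻¹ - w⁻¹)) =o[l] fun a => g a ^ 2 := by
    have : (fun a => (b a)⁻¹ - w⁻¹) =o[l] fun _ => (1 : ℝ) := by
      rw [isLittleO_one_iff]
      simpa using (hb.inv₀ hw.ne').sub_const w⁻¹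
    simpa using (hlin.pow 2).mul_isLittleO this
  refine (e1.add ((e2.add e3).const_mul_left (κ / 2))).congr_left fun a => ?_
  have := (hbpos a).ne'
  field_simp
  ring

end Scalar

/-! ### The rescaled minimization problem: consistency and existence -/

section Deterministic

variable {ι κ' β : Type*} [Fintype ι] [Fintype κ'] [Fintype β]

/-- The mean vector `w e^{Xη}`, relative to the vector `w` at `η = 0`. -/
def relMean (w : ι → ℝ) (X : Matrix ι κ' ℝ) (η : κ' → ℝ) : ι → ℝ :=
  fun i => w i * Real.exp ((X *ᵥ η) i)

/-- The divergence `∑ bᵢ f(pᵢ / bᵢ)` between `p` and `b = w e^{Xη}`. -/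
def relDiv (f : ℝ → ℝ) (w : ι → ℝ) (X : Matrix ι κ' ℝ) (p : ι → ℝ) (η : κ' → ℝ) : ℝ :=
  ∑ i, relMean w X η i * f (p i / relMean w X η i)

/-- The parameters `η` with `Kᵀ (w e^{Xη}) = Kᵀ w`. -/
def relSpace (w : ι → ℝ) (X : Matrix ι κ' ℝ) (K : Matrix ι β ℝ) : Set (κ' → ℝ) :=
  {η | Kᵀ *ᵥ relMean w X η = Kᵀ *ᵥ w}

variable {f : ℝ → ℝ} {κ : ℝ} {w : ι → ℝ} {X : Matrix ι κ' ℝ} {K : Matrix ι β ℝ}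
variable {α : Type*} {l : Filter α} {p : α → ι → ℝ} {η : α → κ' → ℝ}

lemma relMean_zero : relMean w X 0 = w := by
  ext i; simp [relMean]

lemma zero_mem_relSpace : (0 : κ' → ℝ) ∈ relSpace w X K := by
  simp [relSpace, relMean_zero]

lemma continuous_relMean : Continuous (relMean w X) := by
  unfold relMean
  refine continuous_pi fun i => ?_
  have : Continuous fun η : κ' → ℝ => X *ᵥ η := by fun_prop
  fun_prop

lemma relMean_pos (hw : ∀ i, 0 < w i) (η : κ' → ℝ) (i : ι) : 0 < relMean w X η i :=
  mul_pos (hw i) (Real.exp_pos _)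

lemma isClosed_relSpace : IsClosed (relSpace w X K) := by
  have : Continuous fun η : κ' → ℝ => Kᵀ *ᵥ relMean w X η := by
    have := continuous_relMean (w := w) (X := X)
    fun_prop
  exact isClosed_eq this continuous_const

lemma IsQuadraticMin.term_nonneg (hf : IsQuadraticMin f κ) (hw : ∀ i, 0 < w i) {q : ι → ℝ}
    (hq : ∀ i, 0 < q i) (η : κ' → ℝ) (i : ι) :
    0 ≤ relMean w X η i * f (q i / relMean w X η i) :=
  mul_nonneg (relMean_pos hw η i).le (hf.nonneg _ (div_pos (hq i) (relMean_pos hw η i)))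

lemma eventually_pos_of_tendsto (hw : ∀ i, 0 < w i) (hp : Tendsto p l (𝓝 w)) :
    ∀ᶠ a in l, ∀ i, 0 < p a i :=
  eventually_all.2 fun i =>
    ((tendsto_pi_nhds.1 hp) i).eventually (eventually_gt_nhds (hw i))

lemma continuous_relDiv (hf : IsQuadraticMin f κ) (hw : ∀ i, 0 < w i) {q : ι → ℝ}
    (hq : ∀ i, 0 < q i) : Continuous (relDiv f w X q) := by
  unfold relDiv
  refine continuous_finsetSum _ fun i _ => ?_
  have h1 : Continuous fun η => relMean w X η i :=
    (continuous_apply i).comp continuous_relMean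
  refine h1.mul (hf.continuousOn.comp_continuous
    (continuous_const.div h1 fun η => (relMean_pos hw η i).ne')
    fun η => div_pos (hq i) (relMean_pos hw η i))

lemma tendsto_relDiv_zero (hf : IsQuadraticMin f κ) (hw : ∀ i, 0 < w i)
    (hp : Tendsto p l (𝓝 w)) : Tendsto (fun a => relDiv f w X (p a) 0) l (𝓝 0) := by
  simp only [relDiv, relMean_zero]
  rw [← Finset.sum_const_zero (s := (Finset.univ : Finset ι))]
  refine tendsto_finsetSum _ fun i _ => ?_
  have h1 : Tendsto (fun a => p a i / w i) l (𝓝 1) := by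
    simpa [(hw i).ne'] using ((tendsto_pi_nhds.1 hp) i).div_const (w i)
  have h2 : Tendsto f (𝓝 1) (𝓝 0) := by
    have := (hf.continuousOn.continuousAt (Ioi_mem_nhds one_pos)).tendsto
    rwa [hf.map_one] at this
  simpa using (h2.comp h1).const_mul (w i)

lemma tendsto_relMean_of_tendsto_relDiv (hf : IsQuadraticMin f κ) (hw : ∀ i, 0 < w i)
    (hp : Tendsto p l (𝓝 w)) (h : Tendsto (fun a => relDiv f w X (p a) (η a)) l (𝓝 0)) :
    Tendsto (fun a => relMean w X (η a)) l (𝓝 w) := by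
  refine tendsto_pi_nhds.2 fun i => ?_
  refine hf.tendsto_of_tendsto_term (hw i) ((tendsto_pi_nhds.1 hp) i)
    (fun a => relMean_pos hw _ i) ?_
  refine squeeze_zero' ?_ ?_ h
  · filter_upwards [eventually_pos_of_tendsto hw hp] with a ha
    exact hf.term_nonneg hw ha _ i
  · filter_upwards [eventually_pos_of_tendsto hw hp] with a ha
    exact Finset.single_le_sum (f := fun i => relMean w X (η a) i * f (p a i / relMean w X (η a) i))
      (fun j _ => hf.term_nonneg hw ha _ j) (Finset.mem_univ i)

/-- A left inverse `G` of the design matrix recovers the parameter from the log means, so limits and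
rates pass from means to parameters. -/
lemma eq_mulVec_log [DecidableEq κ'] {G : Matrix κ' ι ℝ} (hG : G * X = 1) (hw : ∀ i, 0 < w i)
    (η : κ' → ℝ) : η = G *ᵥ fun i => Real.log (relMean w X η i / w i) := by
  have : (fun i => Real.log (relMean w X η i / w i)) = X *ᵥ η := by
    ext i
    rw [relMean, mul_div_cancel_left₀ _ (hw i).ne', Real.log_exp]
  rw [this, Matrix.mulVec_mulVec, hG, Matrix.one_mulVec]

lemma tendsto_zero_of_tendsto_relMean [DecidableEq κ'] {G : Matrix κ' ι ℝ} (hG : G * X = 1)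
    (hw : ∀ i, 0 < w i) (h : Tendsto (fun a => relMean w X (η a)) l (𝓝 w)) :
    Tendsto η l (𝓝 0) := by
  have h1 : Tendsto (fun a i => Real.log (relMean w X (η a) i / w i)) l (𝓝 0) := by
    refine tendsto_pi_nhds.2 fun i => ?_
    have h2 : Tendsto (fun a => relMean w X (η a) i / w i) l (𝓝 1) := by
      simpa [(hw i).ne'] using ((tendsto_pi_nhds.1 h) i).div_const (w i)
    have := (Real.continuousAt_log one_ne_zero).tendsto.comp h2
    rwa [Real.log_one] at this
  have h3 : Continuous fun v : ι → ℝ => G *ᵥ v := by fun_prop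
  have := (h3.tendsto 0).comp h1
  rw [Matrix.mulVec_zero] at this
  refine this.congr fun a => ?_
  exact (eq_mulVec_log hG hw (η a)).symm

lemma isBigO_mulVec {m n : Type*} [Fintype m] [Fintype n] (M : Matrix m n ℝ) (v : α → n → ℝ) :
    (fun a => M *ᵥ v a) =O[l] v :=
  (M.mulVecLin.toContinuousLinearMap).isBigO_comp v l

/-- A minimizer exists for every table close enough to the true mean vector. -/
lemma exists_minimizer [DecidableEq κ'] (hf : IsQuadraticMin f κ) (hw : ∀ i, 0 < w i)
    {G : Matrix κ' ι ℝ} (hG : G * X = 1) :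
    ∀ᶠ q in 𝓝 w, ∃ η ∈ relSpace w X K, ∀ η' ∈ relSpace w X K,
      relDiv f w X q η ≤ relDiv f w X q η' := by
  have hq : ∀ᶠ q in 𝓝 w, ∀ i, 0 < q i := eventually_pos_of_tendsto hw tendsto_id
  have hbdd : ∀ᶠ q in 𝓝 w, ∀ η, relDiv f w X q η ≤ relDiv f w X q 0 → ‖η‖ < 1 := by
    -- Along this filter on pairs `(q, η)` only `q → w` is imposed and `η` ranges freely over the
    -- sublevel set, so a limit along it is uniform in `η`.
    set F : Filter ((ι → ℝ) × (κ' → ℝ)) :=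
      comap Prod.fst (𝓝 w) ⊓ 𝓟 {a | relDiv f w X a.1 a.2 ≤ relDiv f w X a.1 0} with hF
    have hfst : Tendsto (fun a : (ι → ℝ) × (κ' → ℝ) => a.1) F (𝓝 w) :=
      tendsto_comap.mono_left inf_le_left
    have hle : ∀ᶠ a in F, relDiv f w X a.1 a.2 ≤ relDiv f w X a.1 0 :=
      mem_inf_of_right (mem_principal_self _)
    have h0 : Tendsto (fun a : (ι → ℝ) × (κ' → ℝ) => relDiv f w X a.1 a.2) F (𝓝 0) := by
      refine squeeze_zero' ?_ hle (tendsto_relDiv_zero hf hw hfst)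
      filter_upwards [hfst.eventually hq] with a ha
      exact Finset.sum_nonneg fun i _ => hf.term_nonneg hw ha _ i
    have h1 := tendsto_zero_of_tendsto_relMean hG hw
      (tendsto_relMean_of_tendsto_relDiv hf hw hfst h0)
    have h2 : ∀ᶠ a in F, ‖a.2‖ < 1 := by
      have := h1.norm
      rw [norm_zero] at this
      exact this.eventually_lt_const one_pos
    rw [hF, eventually_inf_principal, eventually_comap] at h2
    filter_upwards [h2] with q hq η hη
    exact hq (q, η) rfl hη
  filter_upwards [hq, hbdd] with q hq hb
  -- Feasible points outside this compact set are worse than the feasible point `0`.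
  set S := relSpace w X K ∩ {η | relDiv f w X q η ≤ relDiv f w X q 0} with hS
  have hcont := continuous_relDiv (X := X) hf hw hq
  have hScl : IsClosed S := isClosed_relSpace.inter (isClosed_le hcont continuous_const)
  have hSc : IsCompact S := by
    refine Metric.isCompact_of_isClosed_isBounded hScl ?_
    refine (Metric.isBounded_ball (x := (0 : κ' → ℝ)) (r := 1)).subset fun η hη => ?_
    simpa using hb η hη.2
  obtain ⟨η, hη, hmin⟩ := hSc.exists_isMinOn ⟨0, zero_mem_relSpace, le_rfl (a := relDiv f w X q 0)⟩
    hcont.continuousOn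
  refine ⟨η, hη.1, fun η' hη' => ?_⟩
  rcases le_total (relDiv f w X q η') (relDiv f w X q 0) with h | h
  · exact hmin ⟨hη', h⟩
  · exact le_trans hη.2 h

end Deterministic

/-! ### The tangent space of the constraint set -/

section Differentiability

variable {ι κ' β : Type*} [Fintype ι] [Fintype κ'] [Fintype β] [DecidableEq ι]
variable {f : ℝ → ℝ} {κ : ℝ} {w : ι → ℝ} {X : Matrix ι κ' ℝ} {K : Matrix ι β ℝ}
variable {α : Type*} {l : Filter α} {p : α → ι → ℝ} {η : α → κ' → ℝ}

/-- Strict differentiability is what the implicit function theorem needs. -/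
lemma hasStrictFDerivAt_relMean :
    HasStrictFDerivAt (relMean w X) (Matrix.diagonal w * X).mulVecLin.toContinuousLinearMap 0 := by
  rw [hasStrictFDerivAt_pi']
  intro i
  have h1 : HasStrictFDerivAt (fun η : κ' → ℝ => (X *ᵥ η) i)
      ((ContinuousLinearMap.proj (R := ℝ) (φ := fun _ : ι => ℝ) i).comp
        X.mulVecLin.toContinuousLinearMap) 0 :=
    ((ContinuousLinearMap.proj (R := ℝ) (φ := fun _ : ι => ℝ) i).comp
        X.mulVecLin.toContinuousLinearMap).hasStrictFDerivAt
  refine (h1.exp.const_mul (w i)).congr_fderiv ?_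
  ext v
  simp [-Matrix.mulVec_mulVec, Matrix.mulVec_diagonal]

/-- First order expansion of the relative mean vector. -/
lemma relMean_sub_isLittleO (h : Tendsto η l (𝓝 0)) :
    (fun a => relMean w X (η a) - w - (Matrix.diagonal w * X) *ᵥ η a) =o[l] η := by
  have := (hasStrictFDerivAt_relMean (w := w) (X := X)).hasFDerivAt.isLittleO.comp_tendsto h
  simpa [Function.comp_def, relMean_zero] using this

/-- The constraints are tangent to the kernel of their derivative. -/
lemma mulVec_isLittleO_of_mem_relSpace (h : Tendsto η l (𝓝 0))
    (hη : ∀ᶠ a in l, η a ∈ relSpace w X K) :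
    (fun a => (Kᵀ * Matrix.diagonal w * X) *ᵥ η a) =o[l] η := by
  have h1 := (isBigO_mulVec (l := l) Kᵀ fun a =>
    relMean w X (η a) - w - (Matrix.diagonal w * X) *ᵥ η a).trans_isLittleO (relMean_sub_isLittleO h)
  refine h1.neg_left.congr' ?_ EventuallyEq.rfl
  filter_upwards [hη] with a ha
  rw [relSpace, Set.mem_ofPred_eq] at ha
  rw [Matrix.mulVec_sub, Matrix.mulVec_sub, ha, sub_self, zero_sub, neg_neg, Matrix.mulVec_mulVec,
    Matrix.mul_assoc]

/-- Every tangent vector is approximated by a point of the constraint set. -/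
lemma exists_relSpace_approx [DecidableEq β] {R : Matrix κ' β ℝ}
    (hR : Kᵀ * Matrix.diagonal w * X * R = 1) :
    ∃ ψ : (κ' → ℝ) → κ' → ℝ,
      (∀ᶠ v in 𝓝[{v | (Kᵀ * Matrix.diagonal w * X) *ᵥ v = 0}] 0, ψ v ∈ relSpace w X K) ∧
      (fun v => ψ v - v) =o[𝓝[{v | (Kᵀ * Matrix.diagonal w * X) *ᵥ v = 0}] 0] id := by
  set M := Kᵀ * Matrix.diagonal w * X with hM
  set f' : (κ' → ℝ) →L[ℝ] (β → ℝ) := M.mulVecLin.toContinuousLinearMap with hf'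
  have hstrict : HasStrictFDerivAt (fun η => Kᵀ *ᵥ relMean w X η) f' 0 := by
    have h1 := (Kᵀ.mulVecLin.toContinuousLinearMap.hasStrictFDerivAt).comp (0 : κ' → ℝ)
      (hasStrictFDerivAt_relMean (w := w) (X := X))
    refine h1.congr_fderiv ?_
    ext v
    simp [hf', hM, Matrix.mulVec_mulVec, Matrix.mul_assoc]
  have hrange : f'.range = ⊤ := by
    rw [LinearMap.range_eq_top]
    intro y
    exact ⟨R *ᵥ y, by simp [hf', Matrix.mulVec_mulVec, hR]⟩
  set φ := hstrict.implicitFunction _ f' hrange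
  classical
  have hker : ∀ v, M *ᵥ v = 0 ↔ v ∈ f'.ker := fun v => Iff.rfl
  -- The implicit function is parametrized by the kernel as a subtype; the value `0` off the kernel
  -- is never used.
  set π : (κ' → ℝ) → f'.ker := fun v => if h : v ∈ f'.ker then ⟨v, h⟩ else 0 with hπ
  have hπv : ∀ v, M *ᵥ v = 0 → ((π v : f'.ker) : κ' → ℝ) = v := fun v hv => by
    simp only [hπ, dif_pos ((hker v).1 hv)]
  have hπ0 : Tendsto π (𝓝[{v | M *ᵥ v = 0}] 0) (𝓝 0) := by
    rw [tendsto_subtype_rng]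
    refine (tendsto_id.mono_left nhdsWithin_le_nhds).congr' ?_
    filter_upwards [self_mem_nhdsWithin] with v hv using (hπv v hv).symm
  refine ⟨fun v => φ (Kᵀ *ᵥ relMean w X 0) (π v), ?_, ?_⟩
  · have h1 := hstrict.map_implicitFunction_eq hrange
    have h2 : Tendsto (fun v => (Kᵀ *ᵥ relMean w X 0, π v)) (𝓝[{v | M *ᵥ v = 0}] 0)
        (𝓝 (Kᵀ *ᵥ relMean w X 0, 0)) := tendsto_const_nhds.prodMk_nhds hπ0
    filter_upwards [h2.eventually h1] with v hv
    rw [relMean_zero] at hv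
    simpa [relSpace, relMean_zero] using hv
  · have h1 := (hstrict.to_implicitFunction hrange).hasFDerivAt.isLittleO.comp_tendsto hπ0
    have h2 : ((fun y : f'.ker => y - 0) ∘ π) =O[𝓝[{v | M *ᵥ v = 0}] 0] (id : (κ' → ℝ) → κ' → ℝ) := by
      refine IsBigO.of_bound 1 ?_
      filter_upwards [self_mem_nhdsWithin] with v hv
      simp [hπv v hv]
    refine (h1.trans_isBigO h2).congr' ?_ EventuallyEq.rfl
    filter_upwards [self_mem_nhdsWithin] with v hv
    have := hstrict.implicitFunction_apply_image hrange
    simp [φ, this, hπv v hv]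

end Differentiability

/-! ### First order expansion of the minimizers -/

section Minimizers

variable {ι κ' β : Type*} [Fintype ι] [Fintype κ'] [Fintype β] [DecidableEq ι] [DecidableEq κ']
  [DecidableEq β]
variable {f : ℝ → ℝ} {κ : ℝ} {w : ι → ℝ} {X : Matrix ι κ' ℝ} {K : Matrix ι β ℝ}
variable {α : Type*} {l : Filter α} {p z : α → ι → ℝ} {η v : α → κ' → ℝ}

/-- The weighted sum of squares `∑ (zᵢ - wᵢ (Xv)ᵢ)² / wᵢ`. -/
def relQuad (w : ι → ℝ) (X : Matrix ι κ' ℝ) (z : ι → ℝ) (v : κ' → ℝ) : ℝ :=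
  ∑ i, (z i - w i * (X *ᵥ v) i) ^ 2 / w i

lemma apply_isBigO_norm {m : Type*} [Fintype m] (u : α → m → ℝ) (i : m) :
    (fun a => u a i) =O[l] fun a => ‖u a‖ :=
  IsBigO.of_bound 1 (Eventually.of_forall fun a => by simpa using norm_le_pi_norm (u a) i)

lemma mulVec_apply_isBigO {m n : Type*} [Fintype m] [Fintype n] (M : Matrix m n ℝ)
    {u : α → n → ℝ} {g : α → ℝ} (hu : u =O[l] g) (i : m) : (fun a => (M *ᵥ u a) i) =O[l] g :=
  (apply_isBigO_norm _ i).trans ((isBigO_mulVec M u).norm_left.trans hu)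

lemma mulVec_apply_isLittleO {m n : Type*} [Fintype m] [Fintype n] (M : Matrix m n ℝ)
    {u : α → n → ℝ} {g : α → ℝ} (hu : u =o[l] g) (i : m) : (fun a => (M *ᵥ u a) i) =o[l] g :=
  (apply_isBigO_norm _ i).trans_isLittleO ((isBigO_mulVec M u).norm_left.trans_isLittleO hu)

/-- The quadratic expansion of the divergence. -/
lemma relDiv_expansion (hf : IsQuadraticMin f κ) (hw : ∀ i, 0 < w i) (hp : Tendsto p l (𝓝 w))
    (hη : η =O[l] fun a => ‖p a - w‖) :
    (fun a => relDiv f w X (p a) (η a) - κ / 2 * relQuad w X (p a - w) (η a)) =o[l]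
      fun a => ‖p a - w‖ ^ 2 := by
  have hg : Tendsto (fun a => ‖p a - w‖) l (𝓝 0) := tendsto_iff_norm_sub_tendsto_zero.1 hp
  have h1 : ∀ i ∈ Finset.univ, _ := fun (i : ι) (_ : i ∈ Finset.univ) => hf.term_expansion (hw i) hg
    (p := fun a => p a i) (x := fun a => (X *ᵥ η a) i)
    (apply_isBigO_norm (fun a => p a - w) i) (mulVec_apply_isBigO X hη i)
  refine (IsLittleO.sum h1).congr_left fun a => ?_
  rw [Finset.sum_apply, Finset.sum_sub_distrib, ← Finset.mul_sum]
  rfl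

lemma relQuad_isBigO {g : α → ℝ} (hz : z =O[l] g) (hv : v =O[l] g) :
    (fun a => relQuad w X (z a) (v a)) =O[l] fun a => g a ^ 2 := by
  unfold relQuad
  refine IsBigO.fun_sum fun i _ => ?_
  have h1 : (fun a => z a i - w i * (X *ᵥ v a) i) =O[l] g :=
    ((apply_isBigO_norm z i).trans hz.norm_left).sub
      ((mulVec_apply_isBigO X hv i).const_mul_left (w i))
  refine ((h1.pow 2).const_mul_left (w i)⁻¹).congr_left fun a => by rw [div_eq_inv_mul]

/-- A difference of squares factors into an `o(g)` and an `O(g)`. -/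
lemma relQuad_sub_isLittleO {g : α → ℝ} (hz : z =O[l] g) (hv : v =O[l] g)
    (h : (fun a => η a - v a) =o[l] g) :
    (fun a => relQuad w X (z a) (η a) - relQuad w X (z a) (v a)) =o[l] fun a => g a ^ 2 := by
  have hη : η =O[l] g := by simpa using h.isBigO.add hv
  unfold relQuad
  simp only [← Finset.sum_sub_distrib]
  refine IsLittleO.fun_sum fun i _ => ?_
  have h1 : (fun a => z a i - w i * (X *ᵥ v a) i) =O[l] g :=
    ((apply_isBigO_norm z i).trans hz.norm_left).sub
      ((mulVec_apply_isBigO X hv i).const_mul_left (w i))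
  have h2 : (fun a => z a i - w i * (X *ᵥ η a) i) =O[l] g :=
    ((apply_isBigO_norm z i).trans hz.norm_left).sub
      ((mulVec_apply_isBigO X hη i).const_mul_left (w i))
  have h3 : (fun a => w i * (X *ᵥ (η a - v a)) i) =o[l] g :=
    (mulVec_apply_isLittleO X h i).const_mul_left (w i)
  refine ((h3.mul_isBigO (h1.add h2)).const_mul_left (-(w i)⁻¹)).congr (fun a => ?_)
    fun a => (sq _).symm
  rw [Matrix.mulVec_sub, Pi.sub_apply]
  ring

/-- Pythagoras' identity at a solution `v` of the normal equations. -/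
lemma relQuad_add (hw : ∀ i, 0 < w i) {y : ι → ℝ} {v d : κ' → ℝ}
    (h : (X *ᵥ d) ⬝ᵥ (y - (Matrix.diagonal w * X) *ᵥ v) = 0) :
    relQuad w X y (v + d) - relQuad w X y v = ∑ i, w i * (X *ᵥ d) i ^ 2 := by
  have h1 : ∑ i, (X *ᵥ d) i * (y i - w i * (X *ᵥ v) i) = 0 := by
    rw [← h, dotProduct]
    simp [← Matrix.mulVec_mulVec, Matrix.mulVec_diagonal]
  rw [relQuad, relQuad, ← Finset.sum_sub_distrib]
  rw [← sub_eq_zero, ← Finset.sum_sub_distrib, ← mul_zero (-2 : ℝ), ← h1, Finset.mul_sum]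
  refine Finset.sum_congr rfl fun i _ => ?_
  have := (hw i).ne'
  rw [Matrix.mulVec_add, Pi.add_apply]
  field_simp
  ring

/-- Minimizers converge at the rate of `p - w`. -/
lemma minimizer_isBigO (hf : IsQuadraticMin f κ) (hw : ∀ i, 0 < w i)
    {G : Matrix κ' ι ℝ} (hG : G * X = 1) (hp : Tendsto p l (𝓝 w))
    (hle : ∀ᶠ a in l, relDiv f w X (p a) (η a) ≤ relDiv f w X (p a) 0) :
    Tendsto η l (𝓝 0) ∧ η =O[l] fun a => ‖p a - w‖ := by
  have hpos := eventually_pos_of_tendsto hw hp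
  have h0 : Tendsto (fun a => relDiv f w X (p a) (η a)) l (𝓝 0) := by
    refine squeeze_zero' ?_ hle (tendsto_relDiv_zero hf hw hp)
    filter_upwards [hpos] with a ha
    exact Finset.sum_nonneg fun i _ => hf.term_nonneg hw ha _ i
  have hb := tendsto_relMean_of_tendsto_relDiv hf hw hp h0
  refine ⟨tendsto_zero_of_tendsto_relMean hG hw hb, ?_⟩
  have hz : (fun a => p a - w) =O[l] fun a => ‖p a - w‖ := (isBigO_refl _ _).norm_right
  have hzero : (fun _ => 0 : α → κ' → ℝ) =O[l] fun a => ‖p a - w‖ := isBigO_zero _ _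
  -- The value at `η = 0` bounds every nonnegative term of the divergence at the minimizer, and each
  -- term dominates a squared difference.
  have hF0 : (fun a => relDiv f w X (p a) 0) =O[l] fun a => ‖p a - w‖ ^ 2 := by
    have h1 := relDiv_expansion (X := X) hf hw hp hzero
    have h2 := (relQuad_isBigO (w := w) (X := X) hz hzero).const_mul_left (κ / 2)
    refine (h1.isBigO.add h2).congr_left fun a => by ring
  have hterm : ∀ i, (fun a => relMean w X (η a) i * f (p a i / relMean w X (η a) i)) =O[l]
      fun a => ‖p a - w‖ ^ 2 := by
    intro i
    refine IsBigO.trans ?_ hF0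
    refine IsBigO.of_bound 1 ?_
    filter_upwards [hpos, hle] with a ha hle
    have h1 := hf.term_nonneg (X := X) hw ha (η a) i
    have h2 := Finset.single_le_sum
      (f := fun i => relMean w X (η a) i * f (p a i / relMean w X (η a) i))
      (fun j _ => hf.term_nonneg hw ha _ j) (Finset.mem_univ i)
    have h3 : relMean w X (η a) i * f (p a i / relMean w X (η a) i) ≤ relDiv f w X (p a) 0 :=
      h2.trans hle
    rw [one_mul, Real.norm_of_nonneg h1, Real.norm_of_nonneg (h1.trans h3)]
    exact h3
  have hbw : ∀ i, (fun a => relMean w X (η a) i / w i - 1) =O[l] fun a => ‖p a - w‖ := by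
    intro i
    have h1 : (fun a => p a i - relMean w X (η a) i) =O[l] fun a => ‖p a - w‖ :=
      IsBigO.of_pow two_ne_zero ((hf.sq_isBigO_term (hw i) ((tendsto_pi_nhds.1 hp) i)
        ((tendsto_pi_nhds.1 hb) i)).trans (hterm i))
    have h2 : (fun a => p a i - w i) =O[l] fun a => ‖p a - w‖ :=
      apply_isBigO_norm (fun a => p a - w) i
    refine ((h2.sub h1).const_mul_left (w i)⁻¹).congr_left fun a => ?_
    have := (hw i).ne'
    field_simp
    ring
  have hlog : (fun a i => Real.log (relMean w X (η a) i / w i)) =O[l] fun a => ‖p a - w‖ := by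
    rw [isBigO_pi]
    intro i
    have h1 : Tendsto (fun a => relMean w X (η a) i / w i) l (𝓝 1) := by
      simpa [(hw i).ne'] using ((tendsto_pi_nhds.1 hb) i).div_const (w i)
    have h2 := (Real.hasDerivAt_log one_ne_zero).isBigO_sub.comp_tendsto h1
    simp only [Real.log_one, sub_zero] at h2
    exact h2.trans (hbw i)
  exact ((isBigO_mulVec G _).trans hlog).congr_left fun a => (eq_mulVec_log hG hw (η a)).symm

/-- Minimizers depend on `p` differentiably at `w`, with derivative `A`, the solution operator of
the linearized weighted least squares problem. -/
theorem minimizer_sub_isLittleO (hf : IsQuadraticMin f κ) (hw : ∀ i, 0 < w i)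
    {G : Matrix κ' ι ℝ} (hG : G * X = 1) {R : Matrix κ' β ℝ}
    (hR : Kᵀ * Matrix.diagonal w * X * R = 1) {A : Matrix κ' ι ℝ}
    (hA : Kᵀ * Matrix.diagonal w * X * A = 0)
    (hnormal : ∀ d, (Kᵀ * Matrix.diagonal w * X) *ᵥ d = 0 → ∀ y,
      (X *ᵥ d) ⬝ᵥ (y - (Matrix.diagonal w * X) *ᵥ (A *ᵥ y)) = 0)
    (hp : Tendsto p l (𝓝 w)) (hmem : ∀ᶠ a in l, η a ∈ relSpace w X K)
    (hmin : ∀ᶠ a in l, ∀ η' ∈ relSpace w X K,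
      relDiv f w X (p a) (η a) ≤ relDiv f w X (p a) η') :
    Tendsto η l (𝓝 0) ∧ η =O[l] (fun a => ‖p a - w‖) ∧
      (fun a => η a - A *ᵥ (p a - w)) =o[l] fun a => ‖p a - w‖ := by
  obtain ⟨hη0, hηO⟩ := minimizer_isBigO hf hw hG hp
    (hmin.mono fun a ha => ha 0 zero_mem_relSpace)
  refine ⟨hη0, hηO, ?_⟩
  set M := Kᵀ * Matrix.diagonal w * X with hM
  set g : α → ℝ := fun a => ‖p a - w‖ with hg
  have hg0 : Tendsto g l (𝓝 0) := tendsto_iff_norm_sub_tendsto_zero.1 hp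
  have hz : (fun a => p a - w) =O[l] g := (isBigO_refl _ _).norm_right
  set vs : α → κ' → ℝ := fun a => A *ᵥ (p a - w) with hvs
  have hvsO : vs =O[l] g := (isBigO_mulVec A _).trans hz
  have hvs0 : Tendsto vs l (𝓝 0) := hvsO.trans_tendsto hg0
  have hMvs : ∀ a, M *ᵥ vs a = 0 := fun a => by
    rw [hvs, Matrix.mulVec_mulVec, hA, Matrix.zero_mulVec]
  -- a competitor in the constraint set
  obtain ⟨ψ, hψ, hψo⟩ := exists_relSpace_approx (w := w) (X := X) (K := K) hR
  have hvsT : Tendsto vs l (𝓝[{v | M *ᵥ v = 0}] 0) :=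
    tendsto_nhdsWithin_iff.2 ⟨hvs0, Eventually.of_forall hMvs⟩
  have hψmem : ∀ᶠ a in l, ψ (vs a) ∈ relSpace w X K := hvsT.eventually hψ
  have hψsub : (fun a => ψ (vs a) - vs a) =o[l] g :=
    (hψo.comp_tendsto hvsT).trans_isBigO hvsO
  have hψO : (fun a => ψ (vs a)) =O[l] g := by simpa using hψsub.isBigO.add hvsO
  -- the projection of the minimizer to the tangent space
  set vh : α → κ' → ℝ := fun a => η a - R *ᵥ (M *ᵥ η a) with hvh
  have hMη : (fun a => M *ᵥ η a) =o[l] g :=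
    (mulVec_isLittleO_of_mem_relSpace hη0 hmem).trans_isBigO hηO
  have hvhsub : (fun a => η a - vh a) =o[l] g := by
    simpa [hvh] using (isBigO_mulVec R fun a => M *ᵥ η a).trans_isLittleO hMη
  have hvhO : vh =O[l] g := by simpa using hηO.sub hvhsub.isBigO
  have hMvh : ∀ a, M *ᵥ vh a = 0 := fun a => by
    rw [hvh, Matrix.mulVec_sub, Matrix.mulVec_mulVec, hR, Matrix.one_mulVec, sub_self]
  have e1 := relDiv_expansion (X := X) hf hw hp hηO
  have e2 := relDiv_expansion (X := X) hf hw hp hψO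
  have e3 := (relQuad_sub_isLittleO (w := w) (X := X) hz hvhO hvhsub).const_mul_left (κ / 2)
  have e4 := (relQuad_sub_isLittleO (w := w) (X := X) hz hvsO hψsub).const_mul_left (κ / 2)
  -- The combination equals `(2 / κ)` times the excess divergence of the competitor `ψ (vs)` over
  -- the minimizer, plus `relQuad` at `vh` minus `relQuad` at `vs`. The excess is nonnegative, so
  -- the `relQuad` difference, a sum of squares by Pythagoras, is `o(g²)`.
  have hE := (((e2.sub e1).add e4).sub e3).const_mul_left (2 / κ)
  have hκ := hf.pos
  have hsq : (fun a => ∑ i, w i * (X *ᵥ (vh a - vs a)) i ^ 2) =o[l] fun a => g a ^ 2 := by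
    refine IsBigO.trans_isLittleO (IsBigO.of_bound 1 ?_) hE
    filter_upwards [hmin, hψmem] with a ha hmem
    have h1 := relQuad_add (X := X) hw (y := p a - w) (v := vs a) (d := vh a - vs a)
      (hnormal _ (by rw [Matrix.mulVec_sub, hMvh, hMvs, sub_zero]) _)
    rw [add_sub_cancel] at h1
    have h2 := ha _ hmem
    rw [one_mul, Real.norm_of_nonneg
      (Finset.sum_nonneg fun i _ => mul_nonneg (hw i).le (sq_nonneg _)), ← h1]
    refine le_trans ?_ (le_abs_self _)
    rw [div_mul_eq_mul_div, le_div_iff₀ hκ]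
    linarith
  have hXd : (fun a => X *ᵥ (vh a - vs a)) =o[l] g := by
    rw [isLittleO_pi]
    intro i
    refine IsLittleO.of_pow (n := 2) ?_ two_ne_zero
    refine IsBigO.trans_isLittleO (IsBigO.of_bound (w i)⁻¹ ?_) hsq
    filter_upwards with a
    rw [Pi.pow_apply, Real.norm_of_nonneg (sq_nonneg _), Real.norm_of_nonneg
      (Finset.sum_nonneg fun i _ => mul_nonneg (hw i).le (sq_nonneg _)), ← div_eq_inv_mul,
      le_div_iff₀ (hw i), mul_comm]
    exact Finset.single_le_sum (f := fun i => w i * (X *ᵥ (vh a - vs a)) i ^ 2)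
      (fun i _ => mul_nonneg (hw i).le (sq_nonneg _)) (Finset.mem_univ i)
  have hd : (fun a => vh a - vs a) =o[l] g := by
    refine ((isBigO_mulVec G _).trans_isLittleO hXd).congr_left fun a => ?_
    rw [Matrix.mulVec_mulVec, hG, Matrix.one_mulVec]
  simpa using hvhsub.add hd

/-- The first order expansions of the minimizers and of their mean vectors, in terms of `ε`
and `δ`. -/
lemma exists_delta_minimizer_sub_le (hf : IsQuadraticMin f κ) (hw : ∀ i, 0 < w i)
    {G : Matrix κ' ι ℝ} (hG : G * X = 1) {R : Matrix κ' β ℝ}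
    (hR : Kᵀ * Matrix.diagonal w * X * R = 1) {A : Matrix κ' ι ℝ}
    (hA : Kᵀ * Matrix.diagonal w * X * A = 0)
    (hnormal : ∀ d, (Kᵀ * Matrix.diagonal w * X) *ᵥ d = 0 → ∀ y,
      (X *ᵥ d) ⬝ᵥ (y - (Matrix.diagonal w * X) *ᵥ (A *ᵥ y)) = 0)
    {ε : ℝ} (hε : 0 < ε) :
    ∃ δ > 0, ∀ q, ‖q - w‖ < δ → (∀ i, 0 < q i) ∧
      (∃ η ∈ relSpace w X K, ∀ η' ∈ relSpace w X K, relDiv f w X q η ≤ relDiv f w X q η') ∧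
      ∀ η ∈ relSpace w X K, (∀ η' ∈ relSpace w X K, relDiv f w X q η ≤ relDiv f w X q η') →
        ‖η - A *ᵥ (q - w)‖ ≤ ε * ‖q - w‖ ∧
        ‖relMean w X η - w - (Matrix.diagonal w * X * A) *ᵥ (q - w)‖ ≤ ε * ‖q - w‖ := by
  -- Pairs of a table and any of its minimizers: the asymptotic statement along the corresponding
  -- filter gives one `δ` valid for all minimizers.
  set s : Set ((ι → ℝ) × (κ' → ℝ)) := {a | a.2 ∈ relSpace w X K ∧
    ∀ η' ∈ relSpace w X K, relDiv f w X a.1 a.2 ≤ relDiv f w X a.1 η'}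
  have hfst : Tendsto (fun a : (ι → ℝ) × (κ' → ℝ) => a.1) (comap Prod.fst (𝓝 w) ⊓ 𝓟 s) (𝓝 w) :=
    tendsto_comap.mono_left inf_le_left
  have hmem : ∀ᶠ a in comap Prod.fst (𝓝 w) ⊓ 𝓟 s, a ∈ s :=
    (eventually_principal.2 fun a ha => ha).filter_mono inf_le_right
  have key := minimizer_sub_isLittleO (p := fun a : (ι → ℝ) × (κ' → ℝ) => a.1)
    (η := fun a : (ι → ℝ) × (κ' → ℝ) => a.2) hf hw hG hR hA hnormal hfst
    (hmem.mono fun a ha => ha.1) (hmem.mono fun a ha => ha.2)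
  have h0 := key.1
  have hO := key.2.1
  have ho := key.2.2
  have hm : (fun a : (ι → ℝ) × (κ' → ℝ) => relMean w X a.2 - w -
      (Matrix.diagonal w * X * A) *ᵥ (a.1 - w)) =o[comap Prod.fst (𝓝 w) ⊓ 𝓟 s]
      fun a => ‖a.1 - w‖ := by
    have h1 := (relMean_sub_isLittleO (w := w) (X := X) h0).trans_isBigO hO
    have h2 := (isBigO_mulVec (Matrix.diagonal w * X) _).trans_isLittleO ho
    refine (h1.add h2).congr_left fun a => ?_
    rw [Matrix.mulVec_sub, Matrix.mulVec_mulVec]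
    abel
  have hboth := (isLittleO_iff.1 ho hε).and (isLittleO_iff.1 hm hε)
  rw [eventually_inf_principal, eventually_comap] at hboth
  obtain ⟨δ, hδ, hball⟩ := Metric.eventually_nhds_iff_ball.1
    ((eventually_pos_of_tendsto hw tendsto_id).and
      ((exists_minimizer (K := K) hf hw hG).and hboth))
  refine ⟨δ, hδ, fun q hq => ?_⟩
  obtain ⟨h1, h2, h3⟩ := hball q (by rwa [Metric.mem_ball, dist_eq_norm])
  refine ⟨h1, h2, fun η hη hmin => ?_⟩
  have h4 := h3 (q, η) rfl ⟨hη, hmin⟩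
  rwa [norm_norm] at h4

end Minimizers

/-! ### Algebra of `I_F`, `B` and `H` -/

section MatrixAlgebra

variable {k t c r : ℕ} {X : Matrix (Fin k) (Fin t) ℝ} {X₀ : Matrix (Fin k) (Fin c) ℝ}
  {C : Matrix (Fin k) (Fin r) ℝ} {w : Fin k → ℝ}

lemma posDef_fisherInfo (hX : X.rank = t) (hw : ∀ i, 0 < w i) : (fisherInfo X w).PosDef := by
  have h1 : (Matrix.diagonal w).PosDef := Matrix.PosDef.diagonal hw
  have hinj : Function.Injective X.mulVec := by
    have h2 : Module.finrank ℝ X.mulVecLin.ker = 0 := by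
      have := X.mulVecLin.finrank_range_add_finrank_ker
      rw [Module.finrank_fin_fun] at this
      change X.rank + _ = t at this
      omega
    exact LinearMap.ker_eq_bot.1 (Submodule.finrank_eq_zero.1 h2)
  have := h1.conjTranspose_mul_mul_same hinj
  simpa [fisherInfo, Matrix.conjTranspose_eq_transpose_of_trivial] using this

lemma isUnit_fisherInfo (hX : X.rank = t) (hw : ∀ i, 0 < w i) :
    IsUnit (fisherInfo X w).det := by
  exact (Matrix.isUnit_iff_isUnit_det _).1 (posDef_fisherInfo hX hw).isUnit

lemma transpose_fisherInfo : (fisherInfo X w)ᵀ = fisherInfo X w := by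
  simp [fisherInfo, Matrix.transpose_mul, Matrix.mul_assoc]

lemma transpose_inv_fisherInfo : ((fisherInfo X w)⁻¹)ᵀ = (fisherInfo X w)⁻¹ := by
  rw [Matrix.transpose_nonsing_inv, transpose_fisherInfo]

lemma transpose_bMatrix :
    (bMatrix X X₀ C w)ᵀ = (constraintMatrix X₀ C)ᵀ * Matrix.diagonal w * X := by
  simp [bMatrix, Matrix.transpose_mul, Matrix.mul_assoc]

lemma transpose_inv_bInfo : ((bInfo X X₀ C w)⁻¹)ᵀ = (bInfo X X₀ C w)⁻¹ := by
  rw [Matrix.transpose_nonsing_inv]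
  congr 1
  simp [bInfo, Matrix.transpose_mul, Matrix.mul_assoc, transpose_inv_fisherInfo]

lemma transpose_hMatrix : (hMatrix X X₀ C w)ᵀ = hMatrix X X₀ C w := by
  simp [hMatrix, Matrix.transpose_mul, Matrix.mul_assoc, transpose_inv_fisherInfo,
    transpose_inv_bInfo]

/-- `I_F⁻¹ Xᵀ D` is a left inverse of `X`. -/
lemma inv_fisherInfo_mul_mul (hX : X.rank = t) (hw : ∀ i, 0 < w i) :
    (fisherInfo X w)⁻¹ * (Xᵀ * Matrix.diagonal w) * X = 1 := by
  rw [Matrix.mul_assoc]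
  exact Matrix.nonsing_inv_mul _ (isUnit_fisherInfo hX hw)

/-- A right inverse of the derivative `Bᵀ` of the constraints: it makes them a submersion at `0` and
gives the projection to the tangent space. -/
lemma transpose_bMatrix_mul_inv (hB : IsUnit (bInfo X X₀ C w)) :
    (bMatrix X X₀ C w)ᵀ * ((fisherInfo X w)⁻¹ * bMatrix X X₀ C w * (bInfo X X₀ C w)⁻¹) = 1 := by
  rw [← Matrix.mul_assoc, ← Matrix.mul_assoc]
  exact Matrix.mul_nonsing_inv _ ((Matrix.isUnit_iff_isUnit_det _).1 hB)

/-- The range of `H` is tangent to the constraints. -/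
lemma transpose_bMatrix_mul_hMatrix (hB : IsUnit (bInfo X X₀ C w)) :
    (bMatrix X X₀ C w)ᵀ * hMatrix X X₀ C w = 0 := by
  have := transpose_bMatrix_mul_inv hB
  rw [hMatrix, Matrix.mul_sub, ← Matrix.mul_assoc _ _ (fisherInfo X w)⁻¹, ← Matrix.mul_assoc _ _
    (bMatrix X X₀ C w)ᵀ, this, Matrix.one_mul, sub_self]

lemma hMatrix_mul_bMatrix (hB : IsUnit (bInfo X X₀ C w)) :
    hMatrix X X₀ C w * bMatrix X X₀ C w = 0 := by
  have := congrArg Matrix.transpose (transpose_bMatrix_mul_hMatrix hB)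
  simpa [Matrix.transpose_mul, transpose_hMatrix] using this

lemma fisherInfo_mul_hMatrix (hX : X.rank = t) (hw : ∀ i, 0 < w i) :
    fisherInfo X w * hMatrix X X₀ C w =
      1 - bMatrix X X₀ C w * ((bInfo X X₀ C w)⁻¹ * (bMatrix X X₀ C w)ᵀ * (fisherInfo X w)⁻¹) := by
  rw [hMatrix, Matrix.mul_sub, Matrix.mul_nonsing_inv _ (isUnit_fisherInfo hX hw)]
  simp only [Matrix.mul_assoc]
  rw [Matrix.mul_nonsing_inv_cancel_left _ _ (isUnit_fisherInfo hX hw)]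

lemma hMatrix_mul_fisherInfo_mul_hMatrix (hX : X.rank = t) (hw : ∀ i, 0 < w i)
    (hB : IsUnit (bInfo X X₀ C w)) :
    hMatrix X X₀ C w * fisherInfo X w * hMatrix X X₀ C w = hMatrix X X₀ C w := by
  rw [Matrix.mul_assoc, fisherInfo_mul_hMatrix hX hw, Matrix.mul_sub, ← Matrix.mul_assoc,
    hMatrix_mul_bMatrix hB]
  simp

/-- `H Xᵀ` solves the normal equations of the linearized constrained least squares problem. -/
lemma hMatrix_normal (hX : X.rank = t) (hw : ∀ i, 0 < w i) {d : Fin t → ℝ}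
    (hd : (bMatrix X X₀ C w)ᵀ *ᵥ d = 0) (y : Fin k → ℝ) :
    (X *ᵥ d) ⬝ᵥ (y - (Matrix.diagonal w * X) *ᵥ ((hMatrix X X₀ C w * Xᵀ) *ᵥ y)) = 0 := by
  have h1 : Xᵀ *ᵥ (y - (Matrix.diagonal w * X) *ᵥ ((hMatrix X X₀ C w * Xᵀ) *ᵥ y)) =
      bMatrix X X₀ C w *ᵥ (((bInfo X X₀ C w)⁻¹ * (bMatrix X X₀ C w)ᵀ * (fisherInfo X w)⁻¹) *ᵥ
        (Xᵀ *ᵥ y)) := by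
    have h2 := fisherInfo_mul_hMatrix (X₀ := X₀) (C := C) hX hw
    have h3 : Xᵀ *ᵥ ((Matrix.diagonal w * X) *ᵥ ((hMatrix X X₀ C w * Xᵀ) *ᵥ y)) =
        (fisherInfo X w * hMatrix X X₀ C w) *ᵥ (Xᵀ *ᵥ y) := by
      simp only [Matrix.mulVec_mulVec, fisherInfo, Matrix.mul_assoc]
    rw [Matrix.mulVec_sub, h3, h2, Matrix.sub_mulVec, Matrix.one_mulVec, sub_sub_cancel,
      Matrix.mulVec_mulVec (M := bMatrix X X₀ C w)]
  rw [← Matrix.vecMul_transpose, ← Matrix.dotProduct_mulVec, h1, Matrix.dotProduct_mulVec,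
    ← Matrix.mulVec_transpose, hd, zero_dotProduct]

/-- By `H I_F H = H`, the variance of `H Xᵀ Z` in direction `v`, computed as for independent Poisson
cells, is given by `H`. -/
lemma dotProduct_hMatrix_mulVec (hX : X.rank = t) (hw : ∀ i, 0 < w i)
    (hB : IsUnit (bInfo X X₀ C w)) (v : Fin t → ℝ) :
    v ⬝ᵥ hMatrix X X₀ C w *ᵥ v = ∑ i, w i * ((hMatrix X X₀ C w * Xᵀ)ᵀ *ᵥ v) i ^ 2 := by
  conv_lhs => rw [← hMatrix_mul_fisherInfo_mul_hMatrix hX hw hB]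
  have h1 : (hMatrix X X₀ C w * Xᵀ)ᵀ = X * hMatrix X X₀ C w := by
    rw [Matrix.transpose_mul, Matrix.transpose_transpose, transpose_hMatrix]
  have h2 : hMatrix X X₀ C w * fisherInfo X w * hMatrix X X₀ C w =
      (X * hMatrix X X₀ C w)ᵀ * (Matrix.diagonal w * (X * hMatrix X X₀ C w)) := by
    simp only [fisherInfo, Matrix.transpose_mul, transpose_hMatrix, Matrix.mul_assoc]
  rw [h1, h2, ← Matrix.mulVec_mulVec, Matrix.dotProduct_mulVec, Matrix.vecMul_transpose,
    ← Matrix.mulVec_mulVec v (Matrix.diagonal w), dotProduct]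
  refine Finset.sum_congr rfl fun i _ => ?_
  rw [Matrix.mulVec_diagonal]
  ring

lemma posSemidef_hMatrix (hX : X.rank = t) (hw : ∀ i, 0 < w i)
    (hB : IsUnit (bInfo X X₀ C w)) : (hMatrix X X₀ C w).PosSemidef := by
  refine Matrix.PosSemidef.of_dotProduct_mulVec_nonneg ?_ fun v => ?_
  · rw [Matrix.IsHermitian, Matrix.conjTranspose_eq_transpose_of_trivial, transpose_hMatrix]
  · rw [star_trivial, dotProduct_hMatrix_mulVec hX hw hB]
    exact Finset.sum_nonneg fun i _ => mul_nonneg (hw i).le (sq_nonneg _)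

lemma sigmaMatrix_eq : sigmaMatrix X X₀ C w =
    (Matrix.diagonal w * X) * hMatrix X X₀ C w * (Matrix.diagonal w * X)ᵀ := by
  simp [sigmaMatrix, Matrix.transpose_mul, Matrix.mul_assoc]

lemma posSemidef_sigmaMatrix (hX : X.rank = t) (hw : ∀ i, 0 < w i)
    (hB : IsUnit (bInfo X X₀ C w)) : (sigmaMatrix X X₀ C w).PosSemidef := by
  have := (posSemidef_hMatrix hX hw hB).mul_mul_conjTranspose_same (Matrix.diagonal w * X)
  rwa [Matrix.conjTranspose_eq_transpose_of_trivial, ← sigmaMatrix_eq] at this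

/-- The scores in the range of `(H Xᵀ)ᵀ` are centered within the strata. -/
lemma sampling_centered (hB : IsUnit (bInfo X X₀ C w)) (v : Fin t → ℝ) :
    X₀ᵀ *ᵥ (fun i => w i * ((hMatrix X X₀ C w * Xᵀ)ᵀ *ᵥ v) i) = 0 := by
  have h1 : (bMatrix X X₀ C w)ᵀ *ᵥ (hMatrix X X₀ C w *ᵥ v) = 0 := by
    rw [Matrix.mulVec_mulVec, transpose_bMatrix_mul_hMatrix hB, Matrix.zero_mulVec]
  have h2 : (fun i => w i * ((hMatrix X X₀ C w * Xᵀ)ᵀ *ᵥ v) i) =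
      Matrix.diagonal w *ᵥ (X *ᵥ (hMatrix X X₀ C w *ᵥ v)) := by
    ext i
    rw [Matrix.mulVec_diagonal, Matrix.transpose_mul, Matrix.transpose_transpose,
      transpose_hMatrix, Matrix.mulVec_mulVec]
  rw [transpose_bMatrix, ← Matrix.mulVec_mulVec, ← Matrix.mulVec_mulVec, constraintMatrix,
    Matrix.transpose_fromCols, Matrix.fromRows_mulVec] at h1
  rw [h2]
  ext h
  exact congrFun h1 (Sum.inl h)

end MatrixAlgebra

/-! ### Multinomial sums over strata -/

section MultinomialSums

open Nat Finset in
/-- The multinomial theorem for a single index set, in terms of exponential weights. -/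
lemma sum_piAntidiag_prod_div_factorial {ι : Type*} [DecidableEq ι] (s : Finset ι) (w : ι → ℂ)
    (M : ℕ) :
    ∑ y ∈ piAntidiag s M, ∏ i ∈ s, w i ^ y i / (y i)! = (∑ i ∈ s, w i) ^ M / M ! := by
  rw [sum_pow_eq_sum_piAntidiag, Finset.sum_div]
  refine Finset.sum_congr rfl fun y hy => ?_
  have h1 := Nat.multinomial_spec s y
  rw [(mem_piAntidiag.1 hy).1] at h1
  have h2 : (∏ i ∈ s, ((y i)! : ℂ)) * Nat.multinomial s y = (M ! : ℂ) := by exact_mod_cast h1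
  have h3 : (∏ i ∈ s, ((y i)! : ℂ)) ≠ 0 :=
    Finset.prod_ne_zero_iff.2 fun i _ => by exact_mod_cast Nat.factorial_ne_zero _
  have h4 : (M ! : ℂ) ≠ 0 := by exact_mod_cast Nat.factorial_ne_zero _
  rw [Finset.prod_div_distrib, div_eq_div_iff h3 h4, ← h2]
  ring

open Nat Finset in
/-- The sum of exponential weights over the tables with prescribed stratum totals. -/
lemma sum_strata_prod_div_factorial {ι σ : Type*} [Fintype ι] [DecidableEq ι] [Fintype σ]
    [DecidableEq σ] (s : ι → σ) (M : σ → ℕ) (w : ι → ℂ) (F : Finset (ι → ℕ))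
    (hF : ∀ x, x ∈ F ↔ ∀ h, ∑ i with s i = h, x i = M h) :
    ∑ x ∈ F, ∏ i, w i ^ x i / (x i)! = ∏ h, (∑ i with s i = h, w i) ^ M h / (M h)! := by
  simp_rw [← sum_piAntidiag_prod_div_factorial]
  rw [Finset.prod_univ_sum]
  symm
  refine Finset.sum_bij' (fun q _ i => q (s i) i) (fun x _ h i => if s i = h then x i else 0)
    ?_ ?_ ?_ ?_ ?_
  · intro q hq
    rw [hF]
    intro h
    rw [← (mem_piAntidiag.1 (Fintype.mem_piFinset.1 hq h)).1]
    refine Finset.sum_congr rfl fun i hi => ?_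
    rw [(Finset.mem_filter.1 hi).2]
  · intro x hx
    rw [hF] at hx
    refine Fintype.mem_piFinset.2 fun h => mem_piAntidiag.2 ⟨?_, ?_⟩
    · rw [← hx h]
      refine Finset.sum_congr rfl fun i hi => ?_
      rw [if_pos (Finset.mem_filter.1 hi).2]
    · intro i hi
      simpa using fun h' => hi (if_neg h')
  · intro q hq
    ext h i
    by_cases hi : s i = h
    · simp [hi]
    · have := (mem_piAntidiag.1 (Fintype.mem_piFinset.1 hq h)).2 i
      rw [if_neg hi]
      by_contra hne
      exact hi (Finset.mem_filter.1 (this (Ne.symm hne))).2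
  · intro x hx
    ext i
    simp
  · intro q hq
    rw [← Finset.prod_fiberwise univ s]
    refine Finset.prod_congr rfl fun h _ => Finset.prod_congr rfl fun i hi => ?_
    obtain rfl := (Finset.mem_filter.1 hi).2
    rfl

end MultinomialSums

/-! ### Generating functions of the sampling laws -/

section Laws

open Nat in
lemma pi_poissonMeasure_real_singleton {k : ℕ} (m : Fin k → ℝ) (hm : ∀ i, 0 < m i)
    (x : Fin k → ℕ) :
    (Measure.pi fun i => poissonMeasure (m i).toNNReal).real {x} =
      ∏ i, Real.exp (-m i) * (m i ^ x i / (x i)!) := by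
  rw [measureReal_def, Measure.pi_singleton, ENNReal.toReal_prod]
  refine Finset.prod_congr rfl fun i _ => ?_
  rw [← measureReal_def, poissonMeasure_real_singleton, Real.coe_toNNReal _ (hm i).le, mul_div_assoc]

lemma integral_pi_poissonMeasure {k : ℕ} (m : Fin k → ℝ) (hm : ∀ i, 0 < m i) (θ : Fin k → ℝ) :
    ∫ x, ∏ i, Complex.exp (θ i * Complex.I) ^ x i
        ∂(Measure.pi fun i => poissonMeasure (m i).toNNReal) =
      ∏ i, Complex.exp (m i * (Complex.exp (θ i * Complex.I) - 1)) := by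
  rw [integral_fintype_prod_eq_prod (f := fun i (x : ℕ) => Complex.exp (θ i * Complex.I) ^ x)]
  refine Finset.prod_congr rfl fun i _ => ?_
  have h1 := charFun_map_cast_poissonMeasure (m i).toNNReal (θ i)
  rw [charFun_apply_real, integral_map .of_discrete (by fun_prop)] at h1
  have h2 : (((m i).toNNReal : ℝ) : ℂ) = m i := by rw [Real.coe_toNNReal _ (hm i).le]
  rw [← h2]
  refine Eq.trans (integral_congr_ae (Eventually.of_forall fun x => ?_)) h1
  rw [← Complex.exp_nat_mul]
  congr 1
  push_cast
  ring

/-- Under product-multinomial sampling the stratum totals are natural numbers, and the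
generating function of the table is a product of powers of linear forms. -/
lemma integral_samplingLaw_strata {k c : ℕ} {X₀ : Matrix (Fin k) (Fin c) ℝ} {s : Fin k → Fin c}
    (hX₀ : ∀ i h, X₀ i h = if s i = h then 1 else 0) {m : Fin k → ℝ} (hm : ∀ i, 0 < m i)
    (hne : samplingLaw X₀ m ≠ 0) :
    ∃ M : Fin c → ℕ, (∀ h, (M h : ℝ) = ∑ i with s i = h, m i) ∧
      ∀ u : Fin k → ℂ, ∫ x, ∏ i, u i ^ x i ∂(samplingLaw X₀ m) =
        ∏ h, (∑ i with s i = h, (m i : ℂ) * u i) ^ M h / (M h : ℂ) ^ M h := by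
  classical
  set μ := Measure.pi fun i => poissonMeasure (m i).toNNReal with hμ
  set S := {x : Fin k → ℕ | (X₀ᵀ *ᵥ fun i => (x i : ℝ)) = X₀ᵀ *ᵥ m} with hS
  have hmul : ∀ v : Fin k → ℝ, ∀ h, (X₀ᵀ *ᵥ v) h = ∑ i with s i = h, v i := by
    intro v h
    simp [Matrix.mulVec, dotProduct, hX₀, Finset.sum_filter]
  have hS0 : μ S ≠ 0 := by
    intro h0
    exact hne (cond_eq_zero_of_meas_eq_zero h0)
  -- Conditioning on a null event would give the zero measure, so some table has the prescribed
  -- totals; these are therefore natural numbers.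
  obtain ⟨x₀, hx₀⟩ := nonempty_of_measure_ne_zero hS0
  refine ⟨fun h => ∑ i with s i = h, x₀ i, fun h => ?_, fun u => ?_⟩
  · have := congrFun hx₀ h
    rw [hmul, hmul] at this
    exact_mod_cast this
  set M : Fin c → ℕ := fun h => ∑ i with s i = h, x₀ i with hM
  have hMm : ∀ h, (M h : ℝ) = ∑ i with s i = h, m i := fun h => by
    have := congrFun hx₀ h
    rw [hmul, hmul] at this
    exact_mod_cast this
  have hSM : ∀ x, x ∈ S ↔ ∀ h, ∑ i with s i = h, x i = M h := by
    intro x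
    rw [hS, Set.mem_ofPred_eq, funext_iff]
    refine forall_congr' fun h => ?_
    rw [hmul, hmul, ← hMm]
    exact_mod_cast Iff.rfl
  have hfin : S.Finite := by
    refine (Set.Finite.pi fun i => Set.finite_Iic (M (s i))).subset fun x hx i _ => ?_
    rw [Set.mem_Iic, ← (hSM x).1 hx (s i)]
    exact Finset.single_le_sum (f := x) (fun _ _ => Nat.zero_le _) (by simp)
  set F := hfin.toFinset with hF
  have hFM : ∀ x, x ∈ F ↔ ∀ h, ∑ i with s i = h, x i = M h := fun x => by
    rw [hF, Set.Finite.mem_toFinset, hSM]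
  have hcoe : S = (F : Set (Fin k → ℕ)) := by simp [hF]
  have hint : ∀ u : Fin k → ℂ, ∫ x in S, ∏ i, u i ^ x i ∂μ =
      (∏ i, (Real.exp (-m i) : ℂ)) * ∏ h, (∑ i with s i = h, (m i : ℂ) * u i) ^ M h /
        (Nat.factorial (M h)) := by
    intro u
    rw [← sum_strata_prod_div_factorial s M _ F hFM, hcoe,
      setIntegral_finset _ (IntegrableOn.finset), Finset.mul_sum]
    refine Finset.sum_congr rfl fun x _ => ?_
    rw [pi_poissonMeasure_real_singleton m hm, Complex.real_smul, Complex.ofReal_prod,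
      ← Finset.prod_mul_distrib, ← Finset.prod_mul_distrib]
    refine Finset.prod_congr rfl fun i _ => ?_
    push_cast
    rw [mul_pow]
    ring
  -- The normalizing constant is the unnormalized generating function at `u = 1`; exponentials and
  -- factorials cancel in the quotient.
  have hreal : ((μ.real S : ℝ) : ℂ) = (∏ i, (Real.exp (-m i) : ℂ)) *
      ∏ h, (M h : ℂ) ^ M h / (Nat.factorial (M h)) := by
    have h1 := hint 1
    simp only [Pi.one_apply, one_pow, Finset.prod_const_one, mul_one] at h1
    rw [setIntegral_const, Complex.real_smul, mul_one] at h1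
    rw [h1]
    congr 1
    refine Finset.prod_congr rfl fun h _ => ?_
    congr 2
    have := hMm h
    have h2 : ((M h : ℝ) : ℂ) = ((∑ i with s i = h, m i : ℝ) : ℂ) := by rw [this]
    push_cast at h2
    exact h2.symm
  have hreal0 : ((μ.real S : ℝ) : ℂ) ≠ 0 := by
    have : μ.real S ≠ 0 := (measureReal_ne_zero_iff (measure_ne_top _ _)).2 hS0
    exact_mod_cast this
  have hlaw : ∫ x, ∏ i, u i ^ x i ∂(samplingLaw X₀ m) =
      ((μ.real S : ℝ) : ℂ)⁻¹ * ∫ x in S, ∏ i, u i ^ x i ∂μ := by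
    rw [samplingLaw, ProbabilityTheory.cond, integral_smul_measure, ENNReal.toReal_inv,
      Complex.real_smul, Complex.ofReal_inv]
    rfl
  rw [hlaw, hint u, hreal, inv_mul_eq_div]
  rw [hreal] at hreal0
  rw [mul_div_mul_left _ _ (left_ne_zero_of_mul hreal0), ← Finset.prod_div_distrib]
  refine Finset.prod_congr rfl fun h _ => ?_
  rw [div_div_div_cancel_right₀]
  exact_mod_cast Nat.factorial_ne_zero _

end Laws

/-! ### Central limit theorem for the table -/

section CentralLimit

/-- Second order expansion of `e^{iτ/√N}` as `N → ∞`. -/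
lemma tendsto_mul_exp_div_sqrt (τ : ℝ) :
    Tendsto (fun N : ℝ => (N : ℂ) * (Complex.exp ((τ / √N : ℝ) * Complex.I) - 1
      - (τ / √N : ℝ) * Complex.I)) atTop (𝓝 (-((τ ^ 2 / 2 : ℝ) : ℂ))) := by
  have hx : Tendsto (fun N : ℝ => τ / √N) atTop (𝓝 0) :=
    Real.tendsto_sqrt_atTop.const_div_atTop τ
  rw [← tendsto_sub_nhds_zero_iff]
  refine squeeze_zero_norm' (a := fun N : ℝ => |τ| ^ 2 * |τ / √N|) ?_ ?_
  · filter_upwards [hx.abs.eventually_lt_const (u := 1) (by simp), eventually_gt_atTop 0]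
      with N h1 hN
    have hsq : √N ^ 2 = N := Real.sq_sqrt hN.le
    have hs : 0 < √N := Real.sqrt_pos.2 hN
    set x : ℝ := τ / √N with hxdef
    have hNx : N * x ^ 2 = τ ^ 2 := by rw [hxdef, div_pow, hsq]; field_simp
    have hnorm : ‖(x : ℂ) * Complex.I‖ = |x| := by simp
    have h2 := Complex.exp_bound (x := x * Complex.I) (by rw [hnorm]; exact h1.le)
      (n := 3) (by norm_num)
    rw [hnorm] at h2
    have e : (N : ℂ) * (Complex.exp (x * Complex.I) - 1 - x * Complex.I) - -((τ ^ 2 / 2 : ℝ) : ℂ) =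
        N * (Complex.exp (x * Complex.I) - ∑ m ∈ Finset.range 3, (x * Complex.I) ^ m / m.factorial) := by
      rw [← hNx]
      simp only [Finset.sum_range_succ, Finset.sum_range_zero]
      simp [mul_pow, Nat.factorial]
      ring
    rw [e, norm_mul, Complex.norm_real, Real.norm_of_nonneg hN.le]
    calc _ ≤ N * (|x| ^ 3 * 1) := by
          refine mul_le_mul_of_nonneg_left (h2.trans ?_) hN.le
          refine mul_le_mul_of_nonneg_left ?_ (by positivity)
          norm_num [Nat.factorial]
      _ = (N * x ^ 2) * |x| := by rw [← sq_abs x]; ring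
      _ = |τ| ^ 2 * |x| := by rw [hNx, sq_abs]
  · have := hx.abs.const_mul (|τ| ^ 2)
    rwa [abs_zero, mul_zero] at this

/-- The Poisson case: one cell. -/
lemma tendsto_poisson_exponent (w τ : ℝ) :
    Tendsto (fun N : ℝ => ((N * w : ℝ) : ℂ) * (Complex.exp ((τ / √N : ℝ) * Complex.I) - 1)
      - (√N * (τ * w) : ℝ) * Complex.I) atTop (𝓝 (-((w * τ ^ 2 / 2 : ℝ) : ℂ))) := by
  have h := (tendsto_mul_exp_div_sqrt τ).const_mul (w : ℂ)
  have e : -((w * τ ^ 2 / 2 : ℝ) : ℂ) = w * -((τ ^ 2 / 2 : ℝ) : ℂ) := by push_cast; ring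
  rw [e]
  refine h.congr' ?_
  filter_upwards [eventually_gt_atTop 0] with N hN
  have hs : (√N : ℂ) ≠ 0 := by exact_mod_cast (Real.sqrt_pos.2 hN).ne'
  have hsq : (N : ℂ) = (√N : ℂ) ^ 2 := by exact_mod_cast (Real.sq_sqrt hN.le).symm
  push_cast
  rw [hsq]
  field_simp

/-- The multinomial case: one stratum. -/
lemma tendsto_stratum_pow {ι : Type*} (s : Finset ι) (hs : s.Nonempty) (w τ : ι → ℝ)
    (hw : ∀ i, 0 < w i) {N : ℕ → ℝ} (hN0 : ∀ j, 0 < N j) (hN : Tendsto N atTop atTop)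
    {M : ℕ → ℕ} (hM : ∀ j, (M j : ℝ) = ∑ i ∈ s, N j * w i) :
    Tendsto (fun j => Complex.exp (-(√(N j) * ∑ i ∈ s, τ i * w i : ℝ) * Complex.I) *
        ((∑ i ∈ s, ((N j * w i : ℝ) : ℂ) * Complex.exp ((τ i / √(N j) : ℝ) * Complex.I)) ^ M j /
          (M j : ℂ) ^ M j)) atTop
      (𝓝 (Complex.exp (-((∑ i ∈ s, w i * (τ i - (∑ i ∈ s, τ i * w i) / ∑ i ∈ s, w i) ^ 2 / 2 : ℝ) :
        ℂ)))) := by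
  set a := ∑ i ∈ s, w i with ha
  have ha0 : 0 < a := Finset.sum_pos (fun i _ => hw i) hs
  -- The stratum mean of `τ`. Subtracting it kills the first order term, so `g` is of order `1 / N`
  -- and `(1 + g)^M` has an exponential limit.
  set b := (∑ i ∈ s, τ i * w i) / a with hb
  have hba : b * a = ∑ i ∈ s, τ i * w i := by rw [hb, div_mul_cancel₀ _ ha0.ne']
  have hMa : ∀ j, (M j : ℝ) = N j * a := fun j => by rw [hM, ha, Finset.mul_sum]
  set g : ℝ → ℂ := fun x => ∑ i ∈ s, ((w i / a : ℝ) : ℂ) *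
    (Complex.exp (((τ i - b) / √x : ℝ) * Complex.I) - 1) with hg
  have hcenter : ∑ i ∈ s, w i / a * (τ i - b) = 0 := by
    simp only [mul_sub, Finset.sum_sub_distrib, ← Finset.sum_mul, ← Finset.sum_div, ← ha]
    rw [div_self ha0.ne', one_mul, hb, Finset.sum_div, sub_eq_zero]
    exact Finset.sum_congr rfl fun i _ => by ring
  have hglim : Tendsto (fun x : ℝ => (x : ℂ) * g x) atTop
      (𝓝 (-((∑ i ∈ s, w i / a * ((τ i - b) ^ 2 / 2) : ℝ) : ℂ))) := by
    have h1 := tendsto_finsetSum s fun i _ =>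
      (tendsto_mul_exp_div_sqrt (τ i - b)).const_mul ((w i / a : ℝ) : ℂ)
    have e : -((∑ i ∈ s, w i / a * ((τ i - b) ^ 2 / 2) : ℝ) : ℂ) =
        ∑ i ∈ s, ((w i / a : ℝ) : ℂ) * -(((τ i - b) ^ 2 / 2 : ℝ) : ℂ) := by
      push_cast
      rw [← Finset.sum_neg_distrib]
      exact Finset.sum_congr rfl fun i _ => by ring
    rw [e]
    refine h1.congr fun x => ?_
    have h2 : ∑ i ∈ s, ((w i / a : ℝ) : ℂ) * ((x : ℂ) * (((τ i - b) / √x : ℝ) * Complex.I)) = 0 := by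
      have : ∑ i ∈ s, ((w i / a : ℝ) : ℂ) * ((x : ℂ) * (((τ i - b) / √x : ℝ) * Complex.I)) =
          ((∑ i ∈ s, w i / a * (τ i - b) : ℝ) : ℂ) * (x / (√x : ℝ) * Complex.I) := by
        push_cast
        rw [Finset.sum_mul]
        exact Finset.sum_congr rfl fun i _ => by ring
      rw [this, hcenter]
      simp
    rw [hg, Finset.mul_sum, ← sub_zero (∑ i ∈ s, (x : ℂ) * _), ← h2, ← Finset.sum_sub_distrib]
    exact Finset.sum_congr rfl fun i _ => by ring
  have hnat : Tendsto (fun n : ℕ => (n : ℂ) * g (n / a)) atTop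
      (𝓝 (a * -((∑ i ∈ s, w i / a * ((τ i - b) ^ 2 / 2) : ℝ) : ℂ))) := by
    have h1 : Tendsto (fun n : ℕ => (n : ℝ) / a) atTop atTop :=
      tendsto_natCast_atTop_atTop.atTop_div_const ha0
    refine ((hglim.comp h1).const_mul (a : ℂ)).congr fun n => ?_
    have : (a : ℂ) ≠ 0 := by exact_mod_cast ha0.ne'
    simp only [Function.comp_apply]
    push_cast
    field_simp
  have hMtop : Tendsto M atTop atTop := by
    rw [← tendsto_natCast_atTop_iff (R := ℝ)]
    simp only [hMa]
    exact hN.atTop_mul_const ha0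
  have h3 := (Complex.tendsto_one_add_pow_exp_of_tendsto hnat).comp hMtop
  have e : (a : ℂ) * -((∑ i ∈ s, w i / a * ((τ i - b) ^ 2 / 2) : ℝ) : ℂ) =
      -((∑ i ∈ s, w i * (τ i - b) ^ 2 / 2 : ℝ) : ℂ) := by
    rw [mul_neg, ← Complex.ofReal_mul, Finset.mul_sum]
    congr 2
    refine Finset.sum_congr rfl fun i _ => ?_
    field_simp
  rw [e] at h3
  refine h3.congr fun j => ?_
  have hsq : (N j : ℂ) = (√(N j) : ℂ) ^ 2 := by exact_mod_cast (Real.sq_sqrt (hN0 j).le).symm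
  have hs0 : (√(N j) : ℂ) ≠ 0 := by exact_mod_cast (Real.sqrt_pos.2 (hN0 j)).ne'
  have hac : (a : ℂ) ≠ 0 := by exact_mod_cast ha0.ne'
  have hMc : (M j : ℂ) = N j * a := by exact_mod_cast hMa j
  -- As `M = N a`, the centering phase splits evenly over the `M` factors, shifting each `τ i` by
  -- `b`.
  have hphase : Complex.exp (-(√(N j) * ∑ i ∈ s, τ i * w i : ℝ) * Complex.I) =
      Complex.exp (-(b / √(N j) : ℝ) * Complex.I) ^ M j := by
    rw [← Complex.exp_nat_mul, hMc, ← hba]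
    congr 1
    push_cast
    rw [hsq]
    field_simp
  have hNa : (M j : ℝ) / a = N j := by rw [hMa, mul_div_cancel_right₀ _ ha0.ne']
  rw [Function.comp_apply, hNa, hphase, ← div_pow, ← mul_pow]
  congr 1
  have hone : ∑ i ∈ s, ((w i / a : ℝ) : ℂ) = 1 := by
    rw [← Complex.ofReal_sum, ← Finset.sum_div, ← ha, div_self ha0.ne', Complex.ofReal_one]
  simp only [hg, mul_sub, mul_one, Finset.sum_sub_distrib, hone]
  rw [add_sub_cancel, Finset.sum_div, Finset.mul_sum]
  refine Finset.sum_congr rfl fun i _ => ?_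
  have hexp : Complex.exp (((τ i - b) / √(N j) : ℝ) * Complex.I) =
      Complex.exp (-(b / √(N j) : ℝ) * Complex.I) * Complex.exp ((τ i / √(N j) : ℝ) * Complex.I) := by
    rw [← Complex.exp_add]
    congr 1
    push_cast
    ring
  rw [hexp, hMc]
  have hN1 : (N j : ℂ) ≠ 0 := by exact_mod_cast (hN0 j).ne'
  push_cast
  field_simp

/-- Reduces the characteristic function of the standardized table to the generating function at
`exp(i τᵢ / √N)`. -/
lemma exp_standardized_eq {k : ℕ} (w τ : Fin k → ℝ) {N : ℝ} (hN : 0 < N) (x : Fin k → ℕ) :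
    Complex.exp ((∑ i, τ i * (√N * (x i / N - w i)) : ℝ) * Complex.I) =
      Complex.exp (-(√N * ∑ i, τ i * w i : ℝ) * Complex.I) *
        ∏ i, Complex.exp ((τ i / √N : ℝ) * Complex.I) ^ x i := by
  simp_rw [← Complex.exp_nat_mul]
  rw [← Complex.exp_sum, ← Complex.exp_add]
  congr 1
  have hs : √N ≠ 0 := (Real.sqrt_pos.2 hN).ne'
  have h1 : (∑ i, τ i * (√N * (x i / N - w i))) =
      -(√N * ∑ i, τ i * w i) + ∑ i, x i * (τ i / √N) := by
    rw [Finset.mul_sum, ← Finset.sum_neg_distrib, ← Finset.sum_add_distrib]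
    refine Finset.sum_congr rfl fun i _ => ?_
    have : √N / N = 1 / √N := by rw [Real.sqrt_div_self']
    calc _ = τ i * x i * (√N / N) - √N * (τ i * w i) := by ring
      _ = _ := by rw [this]; ring
  rw [h1]
  push_cast
  rw [add_mul, Finset.sum_mul]
  congr 1
  exact Finset.sum_congr rfl fun i _ => by ring

/-- The central limit theorem for the sampling schemes, in terms of characteristic functions.
The limit is explicit only at scores that are centered within the strata. -/
theorem exists_tendsto_integral_exp_samplingLaw {k c : ℕ} {X₀ : Matrix (Fin k) (Fin c) ℝ}
    (hX₀ : IsSamplingMatrix X₀) {w : Fin k → ℝ} (hw : ∀ i, 0 < w i) {N : ℕ → ℝ}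
    (hN0 : ∀ j, 0 < N j) (hN : Tendsto N atTop atTop)
    (hne : ∀ j, samplingLaw X₀ (fun i => N j * w i) ≠ 0) :
    ∃ Q : (Fin k → ℝ) → ℝ, Continuous Q ∧
      (∀ τ, X₀ᵀ *ᵥ (fun i => w i * τ i) = 0 → Q τ = ∑ i, w i * τ i ^ 2) ∧
      ∀ τ, Tendsto (fun j => ∫ x, Complex.exp
          ((∑ i, τ i * (√(N j) * (x i / N j - w i)) : ℝ) * Complex.I)
          ∂(samplingLaw X₀ fun i => N j * w i)) atTop
        (𝓝 (Complex.exp (-((Q τ / 2 : ℝ) : ℂ)))) := by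
  have hm : ∀ j i, 0 < N j * w i := fun j i => mul_pos (hN0 j) (hw i)
  rcases hX₀ with rfl | ⟨s, hs, hX₀⟩
  · refine ⟨fun τ => ∑ i, w i * τ i ^ 2, by fun_prop, fun τ _ => rfl, fun τ => ?_⟩
    have h1 := tendsto_finsetProd Finset.univ fun i _ =>
      (Complex.continuous_exp.tendsto _).comp ((tendsto_poisson_exponent (w i) (τ i)).comp hN)
    have e : ∏ i, Complex.exp (-((w i * τ i ^ 2 / 2 : ℝ) : ℂ)) =
        Complex.exp (-(((∑ i, w i * τ i ^ 2) / 2 : ℝ) : ℂ)) := by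
      rw [← Complex.exp_sum, Finset.sum_div, Complex.ofReal_sum, Finset.sum_neg_distrib]
    rw [e] at h1
    refine h1.congr fun j => ?_
    simp_rw [exp_standardized_eq w τ (hN0 j)]
    have hlaw : samplingLaw X₀ (fun i => N j * w i) =
        Measure.pi fun i => poissonMeasure (N j * w i).toNNReal := by
      rw [samplingLaw]
      convert! ProbabilityTheory.cond_univ _ using 2
      · ext x
        simp
      · infer_instance
    rw [hlaw, integral_const_mul, integral_pi_poissonMeasure _ (hm j)]
    simp only [Function.comp_apply]
    rw [← Complex.exp_sum, ← Complex.exp_sum, ← Complex.exp_add, Finset.sum_sub_distrib,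
      ← Finset.sum_mul, ← Complex.ofReal_sum, ← Finset.mul_sum]
    congr 1
    ring
  · choose M hM hint using fun j => integral_samplingLaw_strata hX₀ (hm j) (hne j)
    set b : (Fin k → ℝ) → Fin c → ℝ := fun τ h =>
      (∑ i with s i = h, τ i * w i) / ∑ i with s i = h, w i with hb
    -- The variation of `τ` within strata; for centered scores the stratum means vanish and the
    -- Poisson form remains.
    refine ⟨fun τ => ∑ h, ∑ i with s i = h, w i * (τ i - b τ h) ^ 2, by fun_prop,
      fun τ hτ => ?_, fun τ => ?_⟩
    · have hb0 : ∀ h, b τ h = 0 := by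
        intro h
        have h1 := congrFun hτ h
        simp only [Matrix.mulVec, dotProduct, Matrix.transpose_apply, hX₀, ite_mul, one_mul,
          zero_mul, ← Finset.sum_filter, Pi.zero_apply] at h1
        rw [hb]
        simp only
        rw [Finset.sum_congr rfl fun i _ => mul_comm (τ i) (w i), h1, zero_div]
      simp only [hb0, sub_zero]
      exact Finset.sum_fiberwise _ s _
    · have h1 := tendsto_finsetProd Finset.univ fun h _ =>
        tendsto_stratum_pow ({i | s i = h} : Finset (Fin k))
          (by obtain ⟨i, hi⟩ := hs h; exact ⟨i, by simp [hi]⟩) w τ hw hN0 hN (fun j => hM j h)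
      have e : ∏ h, Complex.exp (-((∑ i with s i = h, w i * (τ i - b τ h) ^ 2 / 2 : ℝ) : ℂ)) =
          Complex.exp (-(((∑ h, ∑ i with s i = h, w i * (τ i - b τ h) ^ 2) / 2 : ℝ) : ℂ)) := by
        rw [← Complex.exp_sum, Finset.sum_div, Complex.ofReal_sum, Finset.sum_neg_distrib]
        simp only [Finset.sum_div]
      rw [e] at h1
      refine h1.congr fun j => ?_
      simp_rw [exp_standardized_eq w τ (hN0 j)]
      rw [integral_const_mul, hint j, Finset.prod_mul_distrib, ← Complex.exp_sum]
      congr 2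
      rw [← Finset.sum_mul, Finset.sum_neg_distrib, ← Complex.ofReal_sum, ← Finset.mul_sum,
        Finset.sum_fiberwise]

end CentralLimit

/-! ### Tightness and the delta method -/

section DeltaMethod

lemma norm_exp_mul_I_sub_le (x y : ℝ) :
    ‖Complex.exp (x * Complex.I) - Complex.exp (y * Complex.I)‖ ≤ |x - y| := by
  have h : Complex.exp (x * Complex.I) - Complex.exp (y * Complex.I) =
      Complex.exp (y * Complex.I) * (Complex.exp (Complex.I * (x - y : ℝ)) - 1) := by
    rw [mul_sub, ← Complex.exp_add, mul_one]
    congr 2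
    push_cast
    ring
  rw [h, norm_mul, Complex.norm_exp_ofReal_mul_I, one_mul]
  exact Real.norm_exp_I_mul_ofReal_sub_one_le

variable {k d : ℕ} {Ω : ℕ → Type*} [∀ j, MeasurableSpace (Ω j)] {P : (j : ℕ) → Measure (Ω j)}
  [∀ j, IsProbabilityMeasure (P j)]

/-- The characteristic function of a random vector of `ℝᵈ`. -/
lemma charFun_map_toLp {Ω : Type*} [MeasurableSpace Ω] {P : Measure Ω} {Y : Ω → Fin d → ℝ}
    (hY : AEMeasurable Y P) (τ : EuclideanSpace ℝ (Fin d)) :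
    charFun (P.map fun ω => WithLp.toLp 2 (Y ω)) τ =
      ∫ ω, Complex.exp ((∑ i, τ i * Y ω i : ℝ) * Complex.I) ∂P := by
  rw [charFun_apply, integral_map (by fun_prop) (by fun_prop)]
  rfl

/-- If the characteristic functions converge to a continuous function, the random vectors are
bounded in probability. -/
lemma exists_measureReal_norm_gt_le {Z : (j : ℕ) → Ω j → Fin k → ℝ}
    (hZ : ∀ j, AEMeasurable (Z j) (P j)) {Ψ : (Fin k → ℝ) → ℂ} (hΨ : Continuous Ψ)
    (hlim : ∀ τ, Tendsto (fun j => ∫ ω, Complex.exp ((∑ i, τ i * Z j ω i : ℝ) * Complex.I) ∂(P j))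
      atTop (𝓝 (Ψ τ))) {ε : ℝ} (hε : 0 < ε) :
    ∃ R : ℝ, 0 < R ∧ ∀ j, (P j).real {ω | R < ‖Z j ω‖} ≤ ε := by
  have hmeas : ∀ j, AEMeasurable (fun ω => WithLp.toLp 2 (Z j ω)) (P j) := fun j => by fun_prop
  have : ∀ j, IsProbabilityMeasure ((P j).map fun ω => WithLp.toLp 2 (Z j ω)) := fun j =>
    Measure.isProbabilityMeasure_map (hmeas j)
  have htight := isTightMeasureSet_of_tendsto_charFun
    (μ := fun j => (P j).map fun ω => WithLp.toLp 2 (Z j ω))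
    (f := fun τ : EuclideanSpace ℝ (Fin k) => Ψ τ.ofLp) (by fun_prop) fun τ => by
      simp_rw [charFun_map_toLp (hZ _)]
      exact hlim τ.ofLp
  rw [isTightMeasureSet_iff_exists_isCompact_measure_compl_le] at htight
  obtain ⟨K, hK, hle⟩ := htight (ENNReal.ofReal ε) (by simpa using hε)
  obtain ⟨R, hR0, hR⟩ := hK.isBounded.subset_ball_lt 0 0
  refine ⟨R, hR0, fun j => ?_⟩
  rw [measureReal_def]
  refine ENNReal.toReal_le_of_le_ofReal hε.le ?_
  refine le_trans ?_ (hle _ ⟨j, rfl⟩)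
  rw [Measure.map_apply_of_aemeasurable (hmeas j) hK.isClosed.measurableSet.compl]
  refine measure_mono fun ω hω hmem => ?_
  have h1 := hR hmem
  rw [mem_ball_zero_iff] at h1
  have h2 : ‖Z j ω‖ ≤ ‖WithLp.toLp 2 (Z j ω)‖ :=
    (pi_norm_le_iff_of_nonneg (norm_nonneg _)).2 fun i =>
      PiLp.norm_apply_le (WithLp.toLp 2 (Z j ω)) i
  exact absurd hω (not_lt.2 (h2.trans h1.le))

/-- A form of the delta method: if `Y - A Z` is small compared with `Z` as long as `Z` is small
compared with `ρ → ∞`, then `Y` inherits the limit in law of `A Z`. -/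
theorem tendstoInDistribution_of_linearization {Z : (j : ℕ) → Ω j → Fin k → ℝ}
    (hZ : ∀ j, AEMeasurable (Z j) (P j)) {Y : (j : ℕ) → Ω j → Fin d → ℝ}
    (hY : ∀ j, AEMeasurable (Y j) (P j)) {Ψ : (Fin k → ℝ) → ℂ} (hΨ : Continuous Ψ)
    (hlim : ∀ τ, Tendsto (fun j => ∫ ω, Complex.exp ((∑ i, τ i * Z j ω i : ℝ) * Complex.I) ∂(P j))
      atTop (𝓝 (Ψ τ)))
    {A : Matrix (Fin d) (Fin k) ℝ} {ρ : ℕ → ℝ} (hρ : Tendsto ρ atTop atTop)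
    (hlin : ∀ ε > 0, ∃ δ > 0, ∀ j, ∀ᵐ ω ∂(P j), ‖Z j ω‖ ≤ δ * ρ j →
      ‖Y j ω - A *ᵥ Z j ω‖ ≤ ε * ‖Z j ω‖)
    {S : Matrix (Fin d) (Fin d) ℝ} (hS : S.PosSemidef)
    (hSΨ : ∀ τ, Ψ (Aᵀ *ᵥ τ) = Complex.exp (-((τ ⬝ᵥ S *ᵥ τ / 2 : ℝ) : ℂ))) :
    TendstoInDistribution (fun j ω => WithLp.toLp 2 (Y j ω)) atTop id P
      (multivariateGaussian 0 S) := by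
  refine ⟨fun j => by have := hY j; fun_prop, by fun_prop, ?_⟩
  refine ProbabilityMeasure.tendsto_of_tendsto_charFun (E := EuclideanSpace ℝ (Fin d)) fun τ => ?_
  simp only [ProbabilityMeasure.coe_mk, Measure.map_id]
  rw [charFun_multivariateGaussian hS]
  have e : Complex.exp ((inner ℝ τ (0 : EuclideanSpace ℝ (Fin d)) : ℝ) * Complex.I -
      (τ.ofLp ⬝ᵥ S *ᵥ τ.ofLp : ℝ) / 2) = Ψ (Aᵀ *ᵥ τ.ofLp) := by
    rw [hSΨ]
    simp
  rw [e]
  simp_rw [charFun_map_toLp (hY _)]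
  have hA : ∀ z : Fin k → ℝ, ∑ i, (Aᵀ *ᵥ τ.ofLp) i * z i = ∑ i, τ i * (A *ᵥ z) i := fun z => by
    change (Aᵀ *ᵥ τ.ofLp) ⬝ᵥ z = τ.ofLp ⬝ᵥ (A *ᵥ z)
    rw [Matrix.dotProduct_mulVec, Matrix.mulVec_transpose]
  have hlimA := hlim (Aᵀ *ᵥ τ.ofLp)
  simp_rw [hA] at hlimA
  have hdiff : Tendsto (fun j => ∫ ω, Complex.exp ((∑ i, τ i * Y j ω i : ℝ) * Complex.I) ∂(P j) -
      ∫ ω, Complex.exp ((∑ i, τ i * (A *ᵥ Z j ω) i : ℝ) * Complex.I) ∂(P j)) atTop (𝓝 0) := by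
    rw [Metric.tendsto_nhds]
    intro ε hε
    -- The event `R < ‖Z‖`, where the integrand is at most `2`, costs an extra `ε / 4`; elsewhere
    -- the linearization error costs at most `ε / 2`.
    obtain ⟨R, hR, htight⟩ := exists_measureReal_norm_gt_le hZ hΨ hlim
      (show 0 < ε / 8 by positivity)
    set L := ∑ i, |τ i| with hL
    have hL0 : 0 ≤ L := Finset.sum_nonneg fun i _ => abs_nonneg _
    obtain ⟨δ, hδ, hlin⟩ := hlin (ε / (2 * (L * R + 1))) (by positivity)
    filter_upwards [hρ.eventually_ge_atTop (R / δ)] with j hj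
    rw [div_le_iff₀ hδ, mul_comm] at hj
    have hYj := hY j
    have hZj := hZ j
    have hAZ : AEMeasurable (fun ω => A *ᵥ Z j ω) (P j) :=
      (show Continuous fun z : Fin k → ℝ => A *ᵥ z by fun_prop).measurable.comp_aemeasurable hZj
    have hint : ∀ {V : Ω j → Fin d → ℝ}, AEMeasurable V (P j) →
        Integrable (fun ω => Complex.exp ((∑ i, τ i * V ω i : ℝ) * Complex.I)) (P j) := by
      intro V hV
      refine Integrable.of_bound (C := 1) ?_ (Eventually.of_forall fun ω => ?_)
      · exact (show Continuous fun v : Fin d → ℝ =>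
          Complex.exp ((∑ i, τ i * v i : ℝ) * Complex.I) by fun_prop).measurable.comp_aemeasurable
            hV |>.aestronglyMeasurable
      · rw [Complex.norm_exp_ofReal_mul_I]
    have hnull : NullMeasurableSet {ω | R < ‖Z j ω‖} (P j) :=
      nullMeasurableSet_lt aemeasurable_const hZj.norm
    rw [dist_zero_right, ← integral_sub (hint hYj) (hint hAZ)]
    have hpt : ∀ᵐ ω ∂(P j), ‖Complex.exp ((∑ i, τ i * Y j ω i : ℝ) * Complex.I) -
        Complex.exp ((∑ i, τ i * (A *ᵥ Z j ω) i : ℝ) * Complex.I)‖ ≤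
        ε / 2 + {ω | R < ‖Z j ω‖}.indicator (fun _ => (2 : ℝ)) ω := by
      filter_upwards [hlin j] with ω hω
      by_cases hmem : ω ∈ {ω | R < ‖Z j ω‖}
      · rw [Set.indicator_of_mem hmem]
        refine (norm_sub_le _ _).trans ?_
        rw [Complex.norm_exp_ofReal_mul_I, Complex.norm_exp_ofReal_mul_I]
        linarith
      · rw [Set.indicator_of_notMem hmem, add_zero]
        have hle : ‖Z j ω‖ ≤ R := not_lt.1 hmem
        refine (norm_exp_mul_I_sub_le _ _).trans ?_
        have h1 := hω (hle.trans hj)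
        rw [← Finset.sum_sub_distrib]
        calc |∑ i, (τ i * Y j ω i - τ i * (A *ᵥ Z j ω) i)|
            ≤ ∑ i, |τ i| * ‖Y j ω - A *ᵥ Z j ω‖ := by
              refine (Finset.abs_sum_le_sum_abs _ _).trans (Finset.sum_le_sum fun i _ => ?_)
              rw [← mul_sub, abs_mul]
              exact mul_le_mul_of_nonneg_left (norm_le_pi_norm (Y j ω - A *ᵥ Z j ω) i)
                (abs_nonneg _)
          _ = L * ‖Y j ω - A *ᵥ Z j ω‖ := by rw [← Finset.sum_mul]
          _ ≤ L * (ε / (2 * (L * R + 1)) * R) := by gcongr; exact h1.trans (by gcongr)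
          _ = (L * R) / (L * R + 1) * (ε / 2) := by field_simp
          _ ≤ 1 * (ε / 2) := by
              gcongr
              rw [div_le_one (by positivity)]
              linarith
          _ = ε / 2 := one_mul _
    have hind : Integrable ({ω | R < ‖Z j ω‖}.indicator fun _ => (2 : ℝ)) (P j) :=
      (integrable_const 2).indicator₀ hnull
    calc _ ≤ ∫ ω, (ε / 2 + {ω | R < ‖Z j ω‖}.indicator (fun _ => (2 : ℝ)) ω) ∂(P j) :=
          norm_integral_le_of_norm_le ((integrable_const _).add hind) hpt
      _ = ε / 2 + (P j).real {ω | R < ‖Z j ω‖} * 2 := by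
          rw [integral_add (integrable_const _) hind, integral_indicator₀ hnull]
          simp
      _ < ε := by linarith [htight j]
  simpa using hdiff.add hlimA

end DeltaMethod

/-! ### Removing `N` from the estimation problem -/

section Rescaling

variable {k t c r : ℕ} {X : Matrix (Fin k) (Fin t) ℝ} {X₀ : Matrix (Fin k) (Fin c) ℝ}
  {C : Matrix (Fin k) (Fin r) ℝ} {φ : ℝ → EReal} {w : Fin k → ℝ} {N : ℝ} {θ₀ : Fin t → ℝ}

lemma meanVec_add (hθ₀ : ∀ i, meanVec X θ₀ i = N * w i) (η : Fin t → ℝ) :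
    meanVec X (θ₀ + η) = N • relMean w X η := by
  ext i
  have := hθ₀ i
  rw [meanVec] at this
  rw [meanVec, Matrix.mulVec_add, Pi.add_apply, Real.exp_add, this, Pi.smul_apply, relMean,
    smul_eq_mul, mul_assoc]

lemma add_mem_paramSpace_iff (hN : 0 < N) (hθ₀ : ∀ i, meanVec X θ₀ i = N * w i) {d : Fin r → ℝ}
    (hd : Cᵀ *ᵥ meanVec X θ₀ = d) {x : Fin k → ℕ}
    (hx : (X₀ᵀ *ᵥ fun i => (x i : ℝ)) = X₀ᵀ *ᵥ meanVec X θ₀) (η : Fin t → ℝ) :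
    θ₀ + η ∈ paramSpace X X₀ C d x ↔ η ∈ relSpace w X (constraintMatrix X₀ C) := by
  have h0 : meanVec X θ₀ = N • w := by ext i; simp [hθ₀]
  have h1 : Sum.elim (X₀ᵀ *ᵥ fun i => (x i : ℝ)) d = (constraintMatrix X₀ C)ᵀ *ᵥ (N • w) := by
    rw [hx, ← hd, h0, constraintMatrix, Matrix.transpose_fromCols, Matrix.fromRows_mulVec]
  rw [paramSpace, relSpace, Set.mem_ofPred_eq, Set.mem_ofPred_eq, h1, meanVec_add hθ₀,
    Matrix.mulVec_smul, Matrix.mulVec_smul]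
  exact smul_right_injective _ hN.ne' |>.eq_iff

lemma ereal_coe_finsetSum {ι : Type*} (s : Finset ι) (g : ι → ℝ) :
    ((∑ i ∈ s, g i : ℝ) : EReal) = ∑ i ∈ s, (g i : EReal) := by
  classical
  induction s using Finset.induction_on with
  | empty => simp
  | insert a s ha ih => rw [Finset.sum_insert ha, Finset.sum_insert ha, EReal.coe_add, ih]

/-- With positive counts and means every ratio lies in `(0, ∞)`, so neither `φ 0` nor the
conventions at `0` enter. -/
lemma phiDiv_meanVec_add (hφ : IsPhi φ) (hN : 0 < N) (hw : ∀ i, 0 < w i)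
    (hθ₀ : ∀ i, meanVec X θ₀ i = N * w i) {x : Fin k → ℕ} (hx : ∀ i, 0 < (x i : ℝ) / N)
    (η : Fin t → ℝ) :
    phiDiv φ (fun i => (x i : ℝ)) (meanVec X (θ₀ + η)) =
      ((N * relDiv (fun u => (φ u).toReal) w X (fun i => x i / N) η : ℝ) : EReal) := by
  rw [phiDiv, relDiv, Finset.mul_sum, ereal_coe_finsetSum, meanVec_add hθ₀]
  refine Finset.sum_congr rfl fun i _ => ?_
  have hb := relMean_pos (X := X) hw η i
  have hu : 0 < (x i : ℝ) / N / relMean w X η i := div_pos (hx i) hb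
  rw [phiTerm, Pi.smul_apply, smul_eq_mul, if_neg (mul_pos hN hb).ne', ← div_div, ← mul_assoc,
    EReal.coe_mul, EReal.coe_mul, EReal.coe_mul,
    EReal.coe_toReal (hφ.ne_top _ hu) (hφ.ne_bot _ hu.le)]

lemma isPhiMinimizer_add_iff (hφ : IsPhi φ) (hN : 0 < N) (hw : ∀ i, 0 < w i)
    (hθ₀ : ∀ i, meanVec X θ₀ i = N * w i) {d : Fin r → ℝ} (hd : Cᵀ *ᵥ meanVec X θ₀ = d)
    {x : Fin k → ℕ} (hx : (X₀ᵀ *ᵥ fun i => (x i : ℝ)) = X₀ᵀ *ᵥ meanVec X θ₀)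
    (hx0 : ∀ i, 0 < (x i : ℝ) / N) (η : Fin t → ℝ) :
    IsPhiMinimizer φ X X₀ C d x (θ₀ + η) ↔
      η ∈ relSpace w X (constraintMatrix X₀ C) ∧ ∀ η' ∈ relSpace w X (constraintMatrix X₀ C),
        relDiv (fun u => (φ u).toReal) w X (fun i => x i / N) η ≤
          relDiv (fun u => (φ u).toReal) w X (fun i => x i / N) η' := by
  have hsub : ∀ θ, ∃ η', θ = θ₀ + η' := fun θ => ⟨θ - θ₀, by simp⟩
  have hiff : ∀ η', relDiv (fun u => (φ u).toReal) w X (fun i => x i / N) η ≤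
      relDiv (fun u => (φ u).toReal) w X (fun i => x i / N) η' ↔
      phiDiv φ (fun i => (x i : ℝ)) (meanVec X (θ₀ + η)) ≤
        phiDiv φ (fun i => (x i : ℝ)) (meanVec X (θ₀ + η')) := fun η' => by
    rw [phiDiv_meanVec_add hφ hN hw hθ₀ hx0, phiDiv_meanVec_add hφ hN hw hθ₀ hx0,
      EReal.coe_le_coe_iff, mul_le_mul_iff_right₀ hN]
  rw [IsPhiMinimizer, add_mem_paramSpace_iff hN hθ₀ hd hx]
  refine and_congr_right fun _ => ⟨fun h η' hη' => ?_, fun h θ hθ => ?_⟩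
  · exact (hiff η').2 (h _ ((add_mem_paramSpace_iff hN hθ₀ hd hx η').2 hη'))
  · obtain ⟨η', rfl⟩ := hsub θ
    exact (hiff η').1 (h _ ((add_mem_paramSpace_iff hN hθ₀ hd hx η').1 hθ))

/-- The first order expansion of the minimizers and of their mean vectors, in terms of `ε`
and `δ`. -/
lemma exists_delta_minimizers (hX : X.rank = t) (hφ : IsPhi φ) (hw : ∀ i, 0 < w i)
    (hB : IsUnit (bInfo X X₀ C w)) {ε : ℝ} (hε : 0 < ε) :
    ∃ δ > 0, ∀ p, ‖p - w‖ < δ → (∀ i, 0 < p i) ∧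
      (∃ η ∈ relSpace w X (constraintMatrix X₀ C), ∀ η' ∈ relSpace w X (constraintMatrix X₀ C),
        relDiv (fun u => (φ u).toReal) w X p η ≤ relDiv (fun u => (φ u).toReal) w X p η') ∧
      ∀ η ∈ relSpace w X (constraintMatrix X₀ C),
        (∀ η' ∈ relSpace w X (constraintMatrix X₀ C),
          relDiv (fun u => (φ u).toReal) w X p η ≤ relDiv (fun u => (φ u).toReal) w X p η') →
        ‖η - (hMatrix X X₀ C w * Xᵀ) *ᵥ (p - w)‖ ≤ ε * ‖p - w‖ ∧
        ‖relMean w X η - w - (Matrix.diagonal w * X * (hMatrix X X₀ C w * Xᵀ)) *ᵥ (p - w)‖ ≤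
          ε * ‖p - w‖ := by
  have hR := transpose_bMatrix_mul_inv hB
  have hA : (bMatrix X X₀ C w)ᵀ * (hMatrix X X₀ C w * Xᵀ) = 0 := by
    rw [← Matrix.mul_assoc, transpose_bMatrix_mul_hMatrix hB, Matrix.zero_mul]
  have hnormal := fun (d : Fin t → ℝ) (hd : (bMatrix X X₀ C w)ᵀ *ᵥ d = 0) (y : Fin k → ℝ) =>
    hMatrix_normal hX hw hd y
  rw [transpose_bMatrix] at hR hA
  simp only [transpose_bMatrix] at hnormal
  exact exists_delta_minimizer_sub_le hφ.isQuadraticMin hw (inv_fisherInfo_mul_mul hX hw) hR hA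
    hnormal hε

end Rescaling

end LMLC

end

/-! ### The main theorem -/

/-- Asymptotic normality of the minimum `φ`-divergence estimator in a loglinear model with linear
constraints. The asymptotics runs along an arbitrary sequence of models with the same `X`, `X₀`,
`C`, with true parameters `θ₀ j` whose expected totals `N j` tend to infinity while the normalized
mean vector `m(θ₀ j) / N j = mstar` remains fixed; `n j` is the observed table. -/
theorem theorem2 {k t c r : ℕ}
    (X : Matrix (Fin k) (Fin t) ℝ) (X₀ : Matrix (Fin k) (Fin c) ℝ)
    (C : Matrix (Fin k) (Fin r) ℝ) (hmodel : LMLC.IsLMLC X X₀ C)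
    (φ : ℝ → EReal) (hφ : LMLC.IsPhi φ)
    (dstar : ℕ → Fin r → ℝ) (θ₀ : ℕ → Fin t → ℝ)
    (hθ₀ : ∀ j, Cᵀ *ᵥ LMLC.meanVec X (θ₀ j) = dstar j)
    (N : ℕ → ℝ) (hN : ∀ j, N j = ∑ i, LMLC.meanVec X (θ₀ j) i)
    (hN_top : Tendsto N atTop atTop)
    (mstar : Fin k → ℝ) (hmstar : ∀ j i, LMLC.meanVec X (θ₀ j) i / N j = mstar i)
    (hB : IsUnit (LMLC.bInfo X X₀ C mstar))
    {Ω : ℕ → Type*} [∀ j, MeasurableSpace (Ω j)]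
    (P : (j : ℕ) → Measure (Ω j)) [∀ j, IsProbabilityMeasure (P j)]
    (n : (j : ℕ) → Ω j → Fin k → ℕ)
    (hn : ∀ j, HasLaw (n j) (LMLC.samplingLaw X₀ (LMLC.meanVec X (θ₀ j))) (P j))
    (T : (j : ℕ) → (Fin k → ℕ) → Fin t → ℝ)
    (hT : ∀ j, LMLC.IsMinPhiEstimator φ X X₀ C (dstar j) (T j)) :
    TendstoInDistribution
        (fun j ω => WithLp.toLp 2 (√(N j) • (T j (n j ω) - θ₀ j)))
        atTop id P (multivariateGaussian 0 (LMLC.hMatrix X X₀ C mstar)) ∧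
      TendstoInDistribution
        (fun j ω => WithLp.toLp 2
          ((1 / √(N j)) • (LMLC.meanVec X (T j (n j ω)) - LMLC.meanVec X (θ₀ j))))
        atTop id P (multivariateGaussian 0 (LMLC.sigmaMatrix X X₀ C mstar)) := by
  have hk : Nonempty (Fin k) := by
    by_contra hk
    rw [not_nonempty_iff] at hk
    have : N = fun _ => 0 := funext fun j => by rw [hN, Finset.univ_eq_empty, Finset.sum_empty]
    rw [this] at hN_top
    exact not_tendsto_const_atTop _ _ hN_top
  have hN0 : ∀ j, 0 < N j := fun j => by
    rw [hN]
    exact Finset.sum_pos (fun i _ => Real.exp_pos _) Finset.univ_nonempty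
  have hw : ∀ i, 0 < mstar i := fun i => by
    rw [← hmstar 0 i]
    exact div_pos (Real.exp_pos _) (hN0 0)
  have hm : ∀ j i, LMLC.meanVec X (θ₀ j) i = N j * mstar i := fun j i => by
    rw [← hmstar j i, mul_div_cancel₀ _ (hN0 j).ne']
  have hX := hmodel.rank_design
  have hlaw : ∀ j, HasLaw (n j) (LMLC.samplingLaw X₀ fun i => N j * mstar i) (P j) := fun j => by
    have h := hn j
    rwa [show LMLC.meanVec X (θ₀ j) = fun i => N j * mstar i from funext (hm j)] at h
  have hne : ∀ j, LMLC.samplingLaw X₀ (fun i => N j * mstar i) ≠ 0 := fun j => by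
    rw [← (hlaw j).map_eq]
    have := Measure.isProbabilityMeasure_map (μ := P j) (hlaw j).aemeasurable
    exact IsProbabilityMeasure.ne_zero _
  have htotals : ∀ j, ∀ᵐ ω ∂(P j),
      (X₀ᵀ *ᵥ fun i => (n j ω i : ℝ)) = X₀ᵀ *ᵥ LMLC.meanVec X (θ₀ j) := fun j => by
    refine ae_of_ae_map (p := fun x : Fin k → ℕ => (X₀ᵀ *ᵥ fun i => (x i : ℝ)) =
      X₀ᵀ *ᵥ LMLC.meanVec X (θ₀ j)) (hn j).aemeasurable ?_
    rw [(hn j).map_eq]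
    exact ProbabilityTheory.ae_cond_mem (Set.to_countable _).measurableSet
  obtain ⟨Q, hQc, hQ, hlim⟩ := LMLC.exists_tendsto_integral_exp_samplingLaw
    hmodel.isSamplingMatrix hw hN0 hN_top hne
  set Z : (j : ℕ) → Ω j → Fin k → ℝ := fun j ω i => √(N j) * (n j ω i / N j - mstar i) with hZ
  have hmeas : ∀ {d : ℕ} (j : ℕ) (g : (Fin k → ℕ) → Fin d → ℝ),
      AEMeasurable (fun ω => g (n j ω)) (P j) := fun j g =>
    (Measurable.of_discrete (f := g)).comp_aemeasurable (hn j).aemeasurable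
  have hlimZ : ∀ τ : Fin k → ℝ, Tendsto
      (fun j => ∫ ω, Complex.exp ((∑ i, τ i * Z j ω i : ℝ) * Complex.I) ∂(P j)) atTop
      (nhds (Complex.exp (-((Q τ / 2 : ℝ) : ℂ)))) := fun τ => by
    refine (hlim τ).congr fun j => ?_
    rw [← (hlaw j).integral_comp Measurable.of_discrete.aestronglyMeasurable]
    rfl
  have hΨ : Continuous fun τ : Fin k → ℝ => Complex.exp (-((Q τ / 2 : ℝ) : ℂ)) := by fun_prop
  have hρ : Tendsto (fun j => √(N j)) atTop atTop := Real.tendsto_sqrt_atTop.comp hN_top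
  -- the linearization of the estimator, along the tables with the prescribed totals
  have hlin : ∀ ε > 0, ∃ δ > 0, ∀ j, ∀ᵐ ω ∂(P j), ‖Z j ω‖ ≤ δ * √(N j) →
      ‖√(N j) • (T j (n j ω) - θ₀ j) - (LMLC.hMatrix X X₀ C mstar * Xᵀ) *ᵥ Z j ω‖ ≤
        ε * ‖Z j ω‖ ∧
      ‖(1 / √(N j)) • (LMLC.meanVec X (T j (n j ω)) - LMLC.meanVec X (θ₀ j)) -
        (Matrix.diagonal mstar * X * (LMLC.hMatrix X X₀ C mstar * Xᵀ)) *ᵥ Z j ω‖ ≤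
        ε * ‖Z j ω‖ := by
    intro ε hε
    obtain ⟨δ, hδ, hmin⟩ := LMLC.exists_delta_minimizers hX hφ hw hB hε
    refine ⟨δ / 2, by positivity, fun j => ?_⟩
    filter_upwards [htotals j] with ω hω hle
    have hs : 0 < √(N j) := Real.sqrt_pos.2 (hN0 j)
    set p : Fin k → ℝ := fun i => n j ω i / N j with hp
    have hZp : Z j ω = √(N j) • (p - mstar) := rfl
    have hZnorm : ‖Z j ω‖ = √(N j) * ‖p - mstar‖ := by
      rw [hZp, norm_smul, Real.norm_of_nonneg hs.le]
    have hpw : ‖p - mstar‖ < δ := by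
      rw [hZnorm, mul_comm] at hle
      linarith [le_of_mul_le_mul_right hle hs]
    obtain ⟨hpos, ⟨η₁, hη₁, hη₁min⟩, hall⟩ := hmin p hpw
    have hiff := LMLC.isPhiMinimizer_add_iff (X₀ := X₀) (C := C) hφ (hN0 j) hw (hm j) (hθ₀ j) hω hpos
    set η := T j (n j ω) - θ₀ j with hη
    have hTη : T j (n j ω) = θ₀ j + η := by rw [hη, add_sub_cancel]
    -- Near `w` a minimizer exists, so the estimator must pick one; its arbitrary values elsewhere
    -- matter only on an event of vanishing probability.
    have hTmin := hT j (n j ω) ⟨_, (hiff η₁).2 ⟨hη₁, hη₁min⟩⟩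
    rw [hTη, hiff] at hTmin
    obtain ⟨h1, h2⟩ := hall η hTmin.1 hTmin.2
    constructor
    · rw [hZp, Matrix.mulVec_smul, ← smul_sub, ← hZp, hZnorm, norm_smul,
        Real.norm_of_nonneg hs.le, mul_left_comm]
      exact mul_le_mul_of_nonneg_left h1 hs.le
    · have h3 : (1 / √(N j)) • (LMLC.meanVec X (T j (n j ω)) - LMLC.meanVec X (θ₀ j)) =
          √(N j) • (LMLC.relMean mstar X η - mstar) := by
        have h4 : LMLC.meanVec X (θ₀ j) = N j • mstar := funext (hm j)
        have h5 : 1 / √(N j) * N j = √(N j) := by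
          rw [one_div_mul_eq_div, Real.div_sqrt]
        rw [hTη, LMLC.meanVec_add (hm j), h4, ← smul_sub, smul_smul, h5]
      rw [h3, hZp, Matrix.mulVec_smul, ← smul_sub, ← hZp, hZnorm, norm_smul,
        Real.norm_of_nonneg hs.le, mul_left_comm]
      exact mul_le_mul_of_nonneg_left h2 hs.le
  -- Only scores centered within strata occur here, so the scheme-dependent part of `Q` drops out.
  have hQA : ∀ v, Q ((LMLC.hMatrix X X₀ C mstar * Xᵀ)ᵀ *ᵥ v) =
      v ⬝ᵥ LMLC.hMatrix X X₀ C mstar *ᵥ v := fun v => by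
    rw [hQ _ (LMLC.sampling_centered hB v), LMLC.dotProduct_hMatrix_mulVec hX hw hB]
  have hZmeas : ∀ j, AEMeasurable (Z j) (P j) := fun j =>
    hmeas j fun x i => √(N j) * (x i / N j - mstar i)
  constructor
  · refine LMLC.tendstoInDistribution_of_linearization hZmeas
      (A := LMLC.hMatrix X X₀ C mstar * Xᵀ) (fun j => hmeas j fun x => √(N j) • (T j x - θ₀ j)) hΨ hlimZ hρ (fun ε hε => ?_)
      (LMLC.posSemidef_hMatrix hX hw hB) fun τ => ?_
    · obtain ⟨δ, hδ, h⟩ := hlin ε hε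
      exact ⟨δ, hδ, fun j => (h j).mono fun ω hω hle => (hω hle).1⟩
    · rw [hQA]
  · refine LMLC.tendstoInDistribution_of_linearization hZmeas
      (A := Matrix.diagonal mstar * X * (LMLC.hMatrix X X₀ C mstar * Xᵀ))
      (fun j => hmeas j fun x => (1 / √(N j)) • (LMLC.meanVec X (T j x) - LMLC.meanVec X (θ₀ j)))
      hΨ hlimZ hρ (fun ε hε => ?_) (LMLC.posSemidef_sigmaMatrix hX hw hB) fun τ => ?_
    · obtain ⟨δ, hδ, h⟩ := hlin ε hε
      exact ⟨δ, hδ, fun j => (h j).mono fun ω hω hle => (hω hle).2⟩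
    · rw [Matrix.transpose_mul, ← Matrix.mulVec_mulVec, hQA, LMLC.sigmaMatrix_eq]
      congr 4
      rw [← Matrix.mulVec_mulVec, ← Matrix.mulVec_mulVec, Matrix.dotProduct_mulVec τ,
        Matrix.mulVec_transpose]
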